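/- Conventions. For $C^*$-algebras $A,B$, an $A$-$B$-equivalence bimodule is a complex Banach space $X$ which is a full left Hilbert $A$-module and a full right Hilbert $B$-module (for the same norm), each algebra acting by adjointable operators for the other inner product, with ${}_A\langle x,y\rangle\cdot z=x\cdot\langle y,z\rangle_B$ for all $x,y,z\in X$. Isomorphisms of equivalence bimodules are linear bijections preserving both actions and both inner products. The tensor product $X\otimes_B Z$ of an $A$-$B$- and a $B$-$D$-equivalence bimodule is the completion of the algebraic balanced tensor product with ${}_A\langle x\otimes z,x'\otimes z'\rangle={}_A\langle x\cdot{}_B\langle z,z'\rangle,x'\rangle$ and $\langle x\otimes z,x'\otimes z'\rangle_D=\langle z,\langle x,x'\rangle_B\cdot z'\rangle_D$. All spans below are closed linear spans. The Picard group $\mathrm{Pic}(A)$ is the group of isomorphism classes $[X]$ of $A$-$A$-equivalence bimodules with $[X][Z]=[X\otimes_A Z]$, unit $[A]$, and $[X]^{-1}=[\widetilde X]$, where $\widetilde X$ is the dual bimodule. Let $A\subset C$ be an inclusion of $C^*$-algebras with $\overline{AC}=C$. Let $\mathrm{Equi}(A,C)$ consist of the pairs $(X,Y)$ where $Y$ is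 a $C$-$C$-equivalence bimodule and $X\subset Y$ is a closed subspace with $A\cdot X\subset X$, $X\cdot A\subset X$, ${}_C\langle X,X\rangle\subset A$, $\langle X,X\rangle_C\subset A$, $\overline{{}_C\langle X,X\rangle}=A=\overline{\langle X,X\rangle_C}$ and $\overline{{}_C\langle Y,X\rangle}=C=\overline{\langle Y,X\rangle_C}$. Write $(X,Y)\sim(Z,W)$ if there is an isomorphism $\Phi\colon Y\to W$ of $C$-$C$-equivalence bimodules with $\Phi(X)=Z$. The Picard group $\mathrm{Pic}(A,C)$ of the inclusion is the set of classes $[X,Y]$, with product $[X,Y][Z,W]=[X\otimes_A Z,\,Y\otimes_C W]$, where $X\otimes_A Z$ is identified with the closed span of $\{x\otimes z: x\in X,\ z\in Z\}$ in $Y\otimes_C W$, unit $[A,C]$, and $[X,Y]^{-1}=[\widetilde X,\widetilde Y]$. Statement. Let $A$ be a $C^*$-algebra (not necessarily unital), and regard $A\subset A$ as an inclusion of $C^*$-algebras by the identity map. Then $$\jmath\colon \mathrm{Pic}(A)\to\mathrm{Pic}(A,A),\qquad \jmath([X])=[X,X]$$ is a well-defined isomorphism of groups. In particular $\mathrm{Pic}(A,A)\cong\mathrm{Pic}(A)$.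 -/

import Mathlib

universe u

noncomputable section

/-- The closed linear span of a set. -/
def cspan {E : Type*} [NormedAddCommGroup E] [NormedSpace ℂ E] (s : Set E) : Submodule ℂ E :=
  (Submodule.span ℂ s).topologicalClosure

/-- An `A`-`B`-equivalence bimodule (imprimitivity bimodule): a Banach space `X` which is a full
left Hilbert `A`-module and a full right Hilbert `B`-module, each algebra acting by adjointable
operators for the inner product of the other one, with `⟨x, y⟩_A · z = x · ⟨y, z⟩_B`. -/
structure EquivalenceBimodule (A B : Type u) [NonUnitalCStarAlgebra A]
    [NonUnitalCStarAlgebra B] where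
  /-- the underlying Banach space -/
  carrier : Type u
  [normedAddCommGroup : NormedAddCommGroup carrier]
  [normedSpace : NormedSpace ℂ carrier]
  [completeSpace : CompleteSpace carrier]
  /-- the left action `a · x` is `lact a x` -/
  lact : A →ₗ[ℂ] carrier →ₗ[ℂ] carrier
  /-- the right action `x · b` is `ract b x` -/
  ract : B →ₗ[ℂ] carrier →ₗ[ℂ] carrier
  /-- the left `A`-valued inner product, linear in the first variable -/
  linner : carrier →ₗ[ℂ] carrier →ₗ⋆[ℂ] A
  /-- the right `B`-valued inner product, linear in the second variable -/
  rinner : carrier →ₗ⋆[ℂ] carrier →ₗ[ℂ] B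
  lact_mul : ∀ a a' x, lact (a * a') x = lact a (lact a' x)
  ract_mul : ∀ b b' x, ract (b * b') x = ract b' (ract b x)
  lact_ract : ∀ a b x, lact a (ract b x) = ract b (lact a x)
  linner_lact : ∀ a x y, linner (lact a x) y = a * linner x y
  rinner_ract : ∀ b x y, rinner x (ract b y) = rinner x y * b
  star_linner : ∀ x y, star (linner x y) = linner y x
  star_rinner : ∀ x y, star (rinner x y) = rinner y x
  /-- `⟨x, x⟩_A` is a positive element of `A` -/
  linner_pos : ∀ x, ∃ a, linner x x = star a * a
  /-- `⟨x, x⟩_B` is a positive element of `B` -/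
  rinner_pos : ∀ x, ∃ b, rinner x x = star b * b
  norm_linner : ∀ x, ‖linner x x‖ = ‖x‖ ^ 2
  norm_rinner : ∀ x, ‖rinner x x‖ = ‖x‖ ^ 2
  linner_ract : ∀ b x y, linner (ract b x) y = linner x (ract (star b) y)
  rinner_lact : ∀ a x y, rinner (lact a x) y = rinner x (lact (star a) y)
  linner_full : cspan {a | ∃ x y, linner x y = a} = ⊤
  rinner_full : cspan {b | ∃ x y, rinner x y = b} = ⊤
  lact_linner : ∀ x y z, lact (linner x y) z = ract (rinner y z) x

namespace EquivalenceBimodule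

attribute [instance] normedAddCommGroup normedSpace completeSpace

instance {A B : Type u} [NonUnitalCStarAlgebra A] [NonUnitalCStarAlgebra B] :
    CoeSort (EquivalenceBimodule A B) (Type u) := ⟨carrier⟩

/-- An isomorphism of `A`-`B`-equivalence bimodules: a linear bijection which preserves both
actions and both inner products. -/
structure Iso {A B : Type u} [NonUnitalCStarAlgebra A] [NonUnitalCStarAlgebra B]
    (X Y : EquivalenceBimodule A B) extends X ≃ₗ[ℂ] Y where
  map_lact : ∀ a x, toFun (X.lact a x) = Y.lact a (toFun x)
  map_ract : ∀ b x, toFun (X.ract b x) = Y.ract b (toFun x)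
  map_linner : ∀ x y, Y.linner (toFun x) (toFun y) = X.linner x y
  map_rinner : ∀ x y, Y.rinner (toFun x) (toFun y) = X.rinner x y

/-- `T`, with the map `τ : (x, z) ↦ x ⊗ z`, is the tensor product `X ⊗_B Z` of equivalence
bimodules: `τ` is bilinear, `B`-balanced and compatible with the outer actions, the inner products
are `⟨x ⊗ z, x' ⊗ z'⟩_A = ⟨x · ⟨z, z'⟩_B, x'⟩_A` and
`⟨x ⊗ z, x' ⊗ z'⟩_D = ⟨z, ⟨x, x'⟩_B · z'⟩_D`, and the elementary tensors span a dense subspace of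
the complete space `T`. -/
structure IsTensorProduct {A B D : Type u} [NonUnitalCStarAlgebra A] [NonUnitalCStarAlgebra B]
    [NonUnitalCStarAlgebra D] (X : EquivalenceBimodule A B) (Z : EquivalenceBimodule B D)
    (T : EquivalenceBimodule A D) (τ : X →ₗ[ℂ] Z →ₗ[ℂ] T) : Prop where
  balanced : ∀ b x z, τ (X.ract b x) z = τ x (Z.lact b z)
  lact : ∀ a x z, T.lact a (τ x z) = τ (X.lact a x) z
  ract : ∀ d x z, T.ract d (τ x z) = τ x (Z.ract d z)
  linner : ∀ x z x' z', T.linner (τ x z) (τ x' z') = X.linner (X.ract (Z.linner z z') x) x'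
  rinner : ∀ x z x' z', T.rinner (τ x z) (τ x' z') = Z.rinner z (Z.lact (X.rinner x x') z')
  dense : cspan {t | ∃ x z, τ x z = t} = ⊤

end EquivalenceBimodule

/-! Consequences of the definitions; existence of duals and tensor products. -/

section closedSpan

variable {E F : Type*} [NormedAddCommGroup E] [NormedSpace ℂ E] [NormedAddCommGroup F]
  [NormedSpace ℂ F]

lemma subset_cspan {s : Set E} {x : E} (hx : x ∈ s) : x ∈ cspan s :=
  Submodule.le_topologicalClosure _ (Submodule.subset_span hx)

lemma isClosed_cspan (s : Set E) : IsClosed (cspan s : Set E) :=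
  Submodule.isClosed_topologicalClosure _

lemma cspan_le {s : Set E} {K : Submodule ℂ E} (hK : IsClosed (K : Set E))
    (h : ∀ x ∈ s, x ∈ K) {x : E} (hx : x ∈ cspan s) : x ∈ K :=
  (Submodule.topologicalClosure_minimal _ (Submodule.span_le.2 h) hK) hx

lemma cspan_map {σ : ℂ →+* ℂ} {s : Set E} (f : E →ₛₗ[σ] F) (hf : Continuous f)
    {K : Submodule ℂ F} (hK : IsClosed (K : Set F)) (h : ∀ x ∈ s, f x ∈ K) {x : E}
    (hx : x ∈ cspan s) : f x ∈ K :=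
  cspan_le (K := K.comap f) (hK.preimage hf) h hx

lemma cspan_eq_top_of {s : Set E} {K : Submodule ℂ E} (hs : cspan s = ⊤)
    (hK : IsClosed (K : Set E)) (h : ∀ x ∈ s, x ∈ K) (x : E) : x ∈ K :=
  cspan_le hK h (hs ▸ Submodule.mem_top)

lemma cspan_map_top {σ : ℂ →+* ℂ} {s : Set E} (hs : cspan s = ⊤) (f : E →ₛₗ[σ] F)
    (hf : Continuous f) {K : Submodule ℂ F} (hK : IsClosed (K : Set F)) (h : ∀ x ∈ s, f x ∈ K)
    (x : E) : f x ∈ K :=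
  cspan_map f hf hK h (hs ▸ Submodule.mem_top)

lemma cspan_ext {σ : ℂ →+* ℂ} {s : Set E} (hs : cspan s = ⊤) {f g : E →ₛₗ[σ] F}
    (hf : Continuous f) (hg : Continuous g) (h : ∀ x ∈ s, f x = g x) (x : E) : f x = g x := by
  have := cspan_map_top hs (f - g) (show Continuous fun x => f x - g x from hf.sub hg) (K := ⊥)
    (by simp) (fun x hx => by simp [h x hx]) x
  simpa [sub_eq_zero] using this

end closedSpan

/-- The complex conjugate of a complex normed space. -/
def ConjSpace (X : Type u) : Type u := X

namespace ConjSpace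

variable (X : Type u) [NormedAddCommGroup X] [NormedSpace ℂ X]

instance : NormedAddCommGroup (ConjSpace X) := inferInstanceAs (NormedAddCommGroup X)
instance [CompleteSpace X] : CompleteSpace (ConjSpace X) := inferInstanceAs (CompleteSpace X)

instance : Module ℂ (ConjSpace X) := Module.compHom X (starRingEnd ℂ)

instance : NormedSpace ℂ (ConjSpace X) where
  norm_smul_le c x := by
    refine (norm_smul_le (starRingEnd ℂ c) (show X from x)).trans_eq ?_
    rw [RCLike.norm_conj]; rfl

variable {X}
/-- The conjugate-linear bijection `x ↦ x̃` onto the conjugate space. -/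
def of : X ≃ₗ⋆[ℂ] ConjSpace X where
  toFun x := x
  invFun x := x
  map_add' _ _ := rfl
  map_smul' c x := show c • x = (starRingEnd ℂ (starRingEnd ℂ c)) • x by simp
  left_inv _ := rfl
  right_inv _ := rfl

lemma of_smul (c : ℂ) (x : X) : of (c • x) = starRingEnd ℂ c • of x := map_smulₛₗ _ _ _
lemma of_symm_smul (c : ℂ) (x : ConjSpace X) : of.symm (c • x) = starRingEnd ℂ c • of.symm x :=
  rfl
@[simp] lemma norm_of (x : X) : ‖of x‖ = ‖x‖ := rfl
@[simp] lemma norm_of_symm (x : ConjSpace X) : ‖of.symm x‖ = ‖x‖ := rfl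
lemma continuous_of : Continuous (of : X → ConjSpace X) := continuous_id
lemma continuous_of_symm : Continuous (of.symm : ConjSpace X → X) := continuous_id

end ConjSpace

namespace EquivalenceBimodule

variable {A B D : Type u} [NonUnitalCStarAlgebra A] [NonUnitalCStarAlgebra B]
  [NonUnitalCStarAlgebra D]

open ConjSpace in
/-- The dual `B`-`A`-equivalence bimodule `X̃`. -/
def dual (X : EquivalenceBimodule A B) : EquivalenceBimodule B A where
  carrier := ConjSpace X
  lact := LinearMap.mk₂ ℂ (fun b x => of (X.ract (star b) (of.symm x))) (by simp)
    (by simp [of_smul]) (by simp) (by simp [of_smul, of_symm_smul])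
  ract := LinearMap.mk₂ ℂ (fun a x => of (X.lact (star a) (of.symm x))) (by simp)
    (by simp [of_smul]) (by simp) (by simp [of_smul, of_symm_smul])
  linner := LinearMap.mk₂'ₛₗ _ _ (fun x y => X.rinner (of.symm x) (of.symm y)) (by simp)
    (by simp [of_symm_smul]) (by simp) (by simp [of_symm_smul])
  rinner := LinearMap.mk₂'ₛₗ _ _ (fun x y => X.linner (of.symm x) (of.symm y)) (by simp)
    (by simp [of_symm_smul]) (by simp) (by simp [of_symm_smul])
  lact_mul a a' x := by simp [X.ract_mul]
  ract_mul a a' x := by simp [X.lact_mul]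
  lact_ract a b x := by simp [X.lact_ract]
  linner_lact a x y := by
    simp [← X.star_rinner (of.symm y), X.rinner_ract]
  rinner_ract a x y := by
    simp [← X.star_linner _ (of.symm x), X.linner_lact]
  star_linner x y := by simp [X.star_rinner]
  star_rinner x y := by simp [X.star_linner]
  linner_pos x := X.rinner_pos _
  rinner_pos x := X.linner_pos _
  norm_linner x := X.norm_rinner _
  norm_rinner x := X.norm_linner _
  linner_ract b x y := by simp [X.rinner_lact]
  rinner_lact b x y := by simp [X.linner_ract]
  linner_full := X.rinner_full
  rinner_full := X.linner_full
  lact_linner x y z := by simp [X.star_rinner, X.star_linner, X.lact_linner]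

variable (X : EquivalenceBimodule A B)

/-- The conjugate-linear bijection `x ↦ x̃` of `X` onto its dual. -/
def toDual : X ≃ₗ⋆[ℂ] X.dual := ConjSpace.of

@[simp] lemma norm_toDual (x) : ‖X.toDual x‖ = ‖x‖ := rfl
lemma continuous_toDual : Continuous X.toDual := continuous_id
lemma continuous_toDual_symm : Continuous X.toDual.symm := continuous_id
@[simp] lemma dual_lact (b x) : X.dual.lact b (X.toDual x) = X.toDual (X.ract (star b) x) := rfl
@[simp] lemma dual_ract (b x) : X.dual.ract b (X.toDual x) = X.toDual (X.lact (star b) x) := rfl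
@[simp] lemma dual_linner (x y : X) :
    X.dual.linner (X.toDual x) (X.toDual y) = X.rinner x y := rfl
@[simp] lemma dual_rinner (x y : X) :
    X.dual.rinner (X.toDual x) (X.toDual y) = X.linner x y := rfl

lemma linner_lact_right (a x y) : X.linner x (X.lact a y) = X.linner x y * star a := by
  rw [← X.star_linner, X.linner_lact, star_mul, X.star_linner]

lemma rinner_ract_left (b x y) : X.rinner (X.ract b x) y = star b * X.rinner x y := by
  rw [← X.star_rinner, X.rinner_ract, star_mul, X.star_rinner]

lemma norm_lact_le (a x) : ‖X.lact a x‖ ≤ ‖a‖ * ‖x‖ := by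
  refine (pow_le_pow_iff_left₀ (norm_nonneg _) (by positivity) two_ne_zero).1 ?_
  rw [← X.norm_linner, X.linner_lact, X.linner_lact_right, mul_pow, ← X.norm_linner x]
  calc _ ≤ ‖a‖ * (‖X.linner x x‖ * ‖star a‖) :=
        (norm_mul_le _ _).trans (by gcongr; exact norm_mul_le _ _)
    _ = _ := by rw [norm_star]; ring

lemma norm_ract_le (b x) : ‖X.ract b x‖ ≤ ‖b‖ * ‖x‖ := by
  simpa using X.dual.norm_lact_le (star b) (X.toDual x)

lemma norm_linner_le (x y) : ‖X.linner x y‖ ≤ ‖x‖ * ‖y‖ := by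
  refine (pow_le_pow_iff_left₀ (norm_nonneg _) (by positivity) two_ne_zero).1 ?_
  obtain ⟨c, hc⟩ := X.rinner_pos y
  have h1 : ‖X.linner x y‖ ^ 2 = ‖X.ract (star c) x‖ ^ 2 := by
    rw [pow_two, ← CStarRing.norm_self_mul_star, X.star_linner, ← X.linner_lact, X.lact_linner, hc,
      X.ract_mul, X.linner_ract, X.norm_linner]
  have h2 : ‖c‖ ^ 2 = ‖y‖ ^ 2 := by
    rw [← X.norm_rinner, hc, CStarRing.norm_star_mul_self, pow_two]
  rw [h1, mul_pow, ← h2, ← mul_pow]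
  gcongr
  simpa [mul_comm] using X.norm_ract_le (star c) x

lemma norm_rinner_le (x y) : ‖X.rinner x y‖ ≤ ‖x‖ * ‖y‖ := X.dual.norm_linner_le (X.toDual x) (X.toDual y)

def lactL : A →L[ℂ] X →L[ℂ] X := X.lact.mkContinuous₂ 1 (by simpa using X.norm_lact_le)
def ractL : B →L[ℂ] X →L[ℂ] X := X.ract.mkContinuous₂ 1 (by simpa using X.norm_ract_le)
def linnerL : X →L[ℂ] X →L⋆[ℂ] A := X.linner.mkContinuous₂ 1 (by simpa using X.norm_linner_le)
def rinnerL : X →L⋆[ℂ] X →L[ℂ] B := X.rinner.mkContinuous₂ 1 (by simpa using X.norm_rinner_le)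

@[simp] lemma lactL_apply (a x) : X.lactL a x = X.lact a x := rfl
@[simp] lemma ractL_apply (a x) : X.ractL a x = X.ract a x := rfl
@[simp] lemma linnerL_apply (a x) : X.linnerL a x = X.linner a x := rfl
@[simp] lemma rinnerL_apply (a x) : X.rinnerL a x = X.rinner a x := rfl

@[fun_prop] lemma continuous_lact {α : Type*} [TopologicalSpace α] {f : α → A} {g : α → X}
    (hf : Continuous f) (hg : Continuous g) : Continuous fun t => X.lact (f t) (g t) := by
  simp only [← lactL_apply]; fun_prop
@[fun_prop] lemma continuous_ract {α : Type*} [TopologicalSpace α] {f : α → B} {g : α → X}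
    (hf : Continuous f) (hg : Continuous g) : Continuous fun t => X.ract (f t) (g t) := by
  simp only [← ractL_apply]; fun_prop
@[fun_prop] lemma continuous_rinner {α : Type*} [TopologicalSpace α] {f : α → X} {g : α → X}
    (hf : Continuous f) (hg : Continuous g) : Continuous fun t => X.rinner (f t) (g t) := by
  simp only [← rinnerL_apply]; fun_prop
@[fun_prop] lemma continuous_linner {α : Type*} [TopologicalSpace α] {f : α → X} {g : α → X}
    (hf : Continuous f) (hg : Continuous g) : Continuous fun t => X.linner (f t) (g t) := by
  exact X.dual.continuous_rinner hf hg

lemma eq_of_linner {x y : X} (h : ∀ z, X.linner x z = X.linner y z) : x = y := by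
  have := X.norm_linner (x - y)
  rw [map_sub X.linner, LinearMap.sub_apply, h, sub_self, norm_zero] at this
  exact sub_eq_zero.1 (norm_eq_zero.1 (pow_eq_zero_iff two_ne_zero |>.1 this.symm))

lemma eq_of_rinner {x y : X} (h : ∀ z, X.rinner z x = X.rinner z y) : x = y := by
  have := X.norm_rinner (x - y)
  rw [map_sub, h, sub_self, norm_zero] at this
  exact sub_eq_zero.1 (norm_eq_zero.1 (pow_eq_zero_iff two_ne_zero |>.1 this.symm))

lemma norm_mul_span_le (b : A) (hb : b ∈ Submodule.span ℂ {a | ∃ x y, X.linner x y = a}) :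
    ∃ C : ℝ, 0 ≤ C ∧ ∀ (g : A) (δ : ℝ), (∀ x, ‖X.lact g x‖ ≤ δ * ‖x‖) → ‖g * b‖ ≤ C * δ := by
  induction hb using Submodule.span_induction with
  | mem b hb =>
    obtain ⟨x, y, rfl⟩ := hb
    refine ⟨‖x‖ * ‖y‖, by positivity, fun g δ h => ?_⟩
    rw [← X.linner_lact]
    calc _ ≤ ‖X.lact g x‖ * ‖y‖ := X.norm_linner_le _ _
      _ ≤ (δ * ‖x‖) * ‖y‖ := by gcongr; exact h x
      _ = _ := by ring
  | zero => exact ⟨0, le_rfl, by simp⟩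
  | add b b' _ _ h h' =>
    obtain ⟨C, hC, h⟩ := h
    obtain ⟨C', hC', h'⟩ := h'
    refine ⟨C + C', by positivity, fun g δ hg => ?_⟩
    rw [mul_add, add_mul]
    exact (norm_add_le _ _).trans (add_le_add (h g δ hg) (h' g δ hg))
  | smul c b _ h =>
    obtain ⟨C, hC, h⟩ := h
    refine ⟨‖c‖ * C, by positivity, fun g δ hg => ?_⟩
    rw [mul_smul_comm, norm_smul, mul_assoc]
    gcongr
    exact h g δ hg

lemma norm_one_aux (h : A) (hs : star h = h) (hn : ‖h‖ = 1) (c : ℝ) (hc0 : 0 ≤ c) (hc : c < 1)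
    (hl : ∀ x, ‖X.lact h x‖ ≤ c * ‖x‖) : False := by
  have key : ∀ n : ℕ, ∃ g : A, star g = g ∧ ‖g‖ = 1 ∧ (∃ r, ‖r‖ ≤ 1 ∧ g = h * r) ∧
      ∀ x, ‖X.lact g x‖ ≤ c ^ n * ‖x‖ := by
    intro n
    induction n with
    | zero =>
      refine ⟨h * h, by simp [hs], ?_, ⟨h, hn.le, rfl⟩, fun x => ?_⟩
      · nth_rw 1 [← hs]; rw [CStarRing.norm_star_mul_self, hn, one_mul]
      · refine (X.norm_lact_le _ _).trans ?_
        nth_rw 1 [← hs]; rw [CStarRing.norm_star_mul_self, hn]; simp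
    | succ n ih =>
      obtain ⟨g, hg, hg1, ⟨r, hr, hgr⟩, hgx⟩ := ih
      refine ⟨g * g, by simp [hg], ?_, ⟨r * g, ?_, ?_⟩, fun x => ?_⟩
      · nth_rw 1 [← hg]; rw [CStarRing.norm_star_mul_self, hg1, one_mul]
      · refine (norm_mul_le _ _).trans ?_
        rw [hg1, mul_one]; exact hr
      · rw [← mul_assoc, ← hgr]
      · have e : X.lact (g * g) x = X.lact h (X.lact r (X.lact g x)) := by
          rw [X.lact_mul, ← X.lact_mul h r, ← hgr]
        rw [e, pow_succ']
        calc _ ≤ c * ‖X.lact r (X.lact g x)‖ := hl _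
          _ ≤ c * (1 * (c ^ n * ‖x‖)) := by
            gcongr
            refine (X.norm_lact_le _ _).trans ?_
            gcongr
            exact hgx x
          _ = _ := by ring
  have hmem : h ∈ closure (Submodule.span ℂ {a | ∃ x y, X.linner x y = a} : Set A) := by
    have : h ∈ cspan {a | ∃ x y, X.linner x y = a} := by rw [X.linner_full]; trivial
    exact this
  obtain ⟨b, hb, hd⟩ := Metric.mem_closure_iff.1 hmem (1 / 2) (by norm_num)
  obtain ⟨C, hC, hCb⟩ := X.norm_mul_span_le b hb
  obtain ⟨n, hn2⟩ := exists_pow_lt_of_lt_one (show (0 : ℝ) < 1 / (2 * (C + 1)) by positivity) hc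
  obtain ⟨g, hg, hg1, ⟨r, hr, hgr⟩, hgx⟩ := key n
  have h1 : 1 ≤ ‖g * h‖ := by
    have : ‖g * h * r‖ = 1 := by
      rw [mul_assoc, ← hgr]
      nth_rw 1 [← hg]; rw [CStarRing.norm_star_mul_self, hg1, one_mul]
    calc 1 = ‖g * h * r‖ := this.symm
      _ ≤ ‖g * h‖ * ‖r‖ := norm_mul_le _ _
      _ ≤ ‖g * h‖ * 1 := by gcongr
      _ = _ := mul_one _
  have h2 : ‖g * h‖ ≤ ‖g * b‖ + ‖g * (h - b)‖ := by
    have : g * h = g * b + g * (h - b) := by rw [mul_sub]; abel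
    rw [this]; exact norm_add_le _ _
  have h3 : ‖g * (h - b)‖ < 1 / 2 := by
    refine (norm_mul_le _ _).trans_lt ?_
    rw [hg1, one_mul, ← dist_eq_norm]; exact hd
  have h4 : ‖g * b‖ ≤ 1 / 2 := by
    calc _ ≤ C * c ^ n := hCb g _ hgx
      _ ≤ (C + 1) * (1 / (2 * (C + 1))) := by gcongr; linarith
      _ = 1 / 2 := by field_simp
  linarith

/-- The left action is isometric. -/
lemma norm_le_of_lact (a : A) (c : ℝ) (hc : 0 ≤ c) (h : ∀ x, ‖X.lact a x‖ ≤ c * ‖x‖) :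
    ‖a‖ ≤ c := by
  by_contra! hlt
  have ha : 0 < ‖a‖ := hc.trans_lt hlt
  set k : ℂ := (((‖a‖ ^ 2)⁻¹ : ℝ) : ℂ)
  have hk : ‖k‖ = (‖a‖ ^ 2)⁻¹ := by
    simp [k]
  refine X.norm_one_aux (k • (star a * a)) ?_ ?_ (c / ‖a‖) (by positivity)
    (by rwa [div_lt_one ha]) fun x => ?_
  · simp [k]
  · rw [norm_smul, CStarRing.norm_star_mul_self, hk]; field_simp
  · rw [map_smul, LinearMap.smul_apply, norm_smul, hk, X.lact_mul]
    calc _ ≤ (‖a‖ ^ 2)⁻¹ * (‖a‖ * (c * ‖x‖)) := by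
          gcongr
          refine (X.norm_lact_le _ _).trans ?_
          rw [norm_star]; gcongr; exact h x
      _ = _ := by field_simp

lemma lact_injective {a a' : A} (h : ∀ x, X.lact a x = X.lact a' x) : a = a' := by
  have := X.norm_le_of_lact (a - a') 0 le_rfl (fun x => by simp [h])
  exact sub_eq_zero.1 (norm_le_zero_iff.1 this)

lemma ract_injective {b b' : B} (h : ∀ x, X.ract b x = X.ract b' x) : b = b' := by
  refine star_injective (X.dual.lact_injective fun x => ?_)
  obtain ⟨x, rfl⟩ := X.toDual.surjective x
  simp [h]

lemma isClosed_range_lactL : IsClosed (LinearMap.range X.lactL.toLinearMap : Set (X →L[ℂ] X)) := by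
  have : AntilipschitzWith 1 X.lactL :=
    X.lactL.antilipschitz_of_bound fun a => by
      simpa using X.norm_le_of_lact a _ (norm_nonneg _) (X.lactL a).le_opNorm
  have := this.isClosed_range X.lactL.uniformContinuous
  exact this

lemma norm_le_of_ract (b : B) (c : ℝ) (hc : 0 ≤ c) (h : ∀ x, ‖X.ract b x‖ ≤ c * ‖x‖) :
    ‖b‖ ≤ c := by
  rw [← norm_star]
  refine X.dual.norm_le_of_lact (star b) c hc fun x => ?_
  obtain ⟨x, rfl⟩ := X.toDual.surjective x
  simpa using h x

lemma isClosed_range_ractL : IsClosed (LinearMap.range X.ractL.toLinearMap : Set (X →L[ℂ] X)) := by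
  have : AntilipschitzWith 1 X.ractL :=
    X.ractL.antilipschitz_of_bound fun a => by
      simpa using X.norm_le_of_ract a _ (norm_nonneg _) (X.ractL a).le_opNorm
  have := this.isClosed_range X.ractL.uniformContinuous
  exact this

lemma exists_approx (S : NonUnitalStarSubalgebra ℂ B) (hS : IsClosed (S : Set B)) (q : B)
    (hq : q ∈ S) (ε : ℝ) (hε : 0 < ε) : ∃ e ∈ S, ‖e‖ ≤ 1 ∧ ‖q - q * e‖ < ε := by
  have := hS
  let : PartialOrder S := CStarAlgebra.spectralOrder S
  have : StarOrderedRing S := CStarAlgebra.spectralOrderedRing S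
  have hl := CStarAlgebra.increasingApproximateUnit S
  have := hl.neBot
  have h1 := hl.tendsto_mul_left ⟨q, hq⟩
  have h2 := hl.eventually_norm
  have h3 := Metric.tendsto_nhds.1 h1 ε hε
  obtain ⟨e, he1, he2⟩ := (h2.and h3).exists
  refine ⟨e, e.2, he1, ?_⟩
  rw [dist_comm, dist_eq_norm] at he2
  exact he2

lemma mem_of_ract_mem (S : NonUnitalStarSubalgebra ℂ B) (hS : IsClosed (S : Set B)) (x : X)
    (hx : X.rinner x x ∈ S) (K : Set X) (hK : IsClosed K)
    (h : ∀ e ∈ S, X.ract e x ∈ K) : x ∈ K := by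
  rw [← hK.closure_eq, Metric.mem_closure_iff]
  intro ε hε
  obtain ⟨e, he, he1, heε⟩ := exists_approx S hS _ hx (ε ^ 2 / 2) (by positivity)
  refine ⟨_, h e he, ?_⟩
  rw [dist_eq_norm]
  refine lt_of_pow_lt_pow_left₀ 2 hε.le ?_
  rw [← X.norm_rinner]
  set q := X.rinner x x
  have : X.rinner (x - X.ract e x) (x - X.ract e x) = (q - q * e) - star e * (q - q * e) := by
    simp only [map_sub, LinearMap.sub_apply, X.rinner_ract, X.rinner_ract_left, mul_sub, q,
      mul_assoc]
    abel
  rw [this]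
  calc _ ≤ ‖q - q * e‖ + ‖star e * (q - q * e)‖ := norm_sub_le _ _
    _ ≤ ‖q - q * e‖ + 1 * ‖q - q * e‖ := by
      gcongr
      refine (norm_mul_le _ _).trans ?_
      rw [norm_star]; gcongr
    _ < ε ^ 2 := by linarith

lemma mem_of_lact_mem (S : NonUnitalStarSubalgebra ℂ A) (hS : IsClosed (S : Set A)) (x : X)
    (hx : X.linner x x ∈ S) (K : Set X) (hK : IsClosed K)
    (h : ∀ e ∈ S, X.lact e x ∈ K) : x ∈ K :=
  X.dual.mem_of_ract_mem S hS (X.toDual x) hx K hK fun e he => h (star e) (star_mem he)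

lemma pos_of_lact (a : A) (ha : star a = a)
    (h : ∀ x, ∃ b, X.rinner x (X.lact a x) = star b * b) : ∃ c, a = star c * c := by
  let : PartialOrder A := CStarAlgebra.spectralOrder A
  have : StarOrderedRing A := CStarAlgebra.spectralOrderedRing A
  let : PartialOrder B := CStarAlgebra.spectralOrder B
  have : StarOrderedRing B := CStarAlgebra.spectralOrderedRing B
  have hsa : IsSelfAdjoint a := ha
  have hdec := CFC.posPart_sub_negPart a hsa
  have hpn := CFC.posPart_mul_negPart a
  have hn := CFC.negPart_nonneg a
  have hp := CFC.posPart_nonneg a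
  set p := a⁺
  set n := a⁻
  obtain ⟨s, hs⟩ := CStarAlgebra.nonneg_iff_eq_star_mul_self.1 hn
  obtain ⟨c, hc⟩ := CStarAlgebra.nonneg_iff_eq_star_mul_self.1 hp
  have hn0 : n = 0 := by
    have hsn : star n = n := (IsSelfAdjoint.of_nonneg hn)
    have hx : ∀ x, X.lact (s * n) x = 0 := by
      intro x
      obtain ⟨b, hb⟩ := h (X.lact n x)
      have e : X.rinner (X.lact n x) (X.lact a (X.lact n x)) =
          - X.rinner (X.lact (s * n) x) (X.lact (s * n) x) := by
        rw [← X.lact_mul, ← hdec, sub_mul, hpn, zero_sub, map_neg, LinearMap.neg_apply, map_neg]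
        nth_rw 2 [hs]
        rw [mul_assoc, X.lact_mul, ← X.rinner_lact, ← X.lact_mul]
      obtain ⟨b', hb'⟩ := X.rinner_pos (X.lact (s * n) x)
      have h1 : X.rinner (X.lact (s * n) x) (X.lact (s * n) x) = 0 := by
        apply le_antisymm
        · rw [← neg_nonneg, ← e, hb]; exact star_mul_self_nonneg _
        · rw [hb']; exact star_mul_self_nonneg _
      have := X.norm_rinner (X.lact (s * n) x)
      rw [h1, norm_zero] at this
      exact norm_eq_zero.1 (pow_eq_zero_iff two_ne_zero |>.1 this.symm)
    have h0 : s * n = 0 := X.lact_injective fun x => by simp [hx]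
    have h1 : star n * n = 0 := by
      rw [hsn]; nth_rw 1 [hs]; rw [mul_assoc, h0, mul_zero]
    exact CStarRing.star_mul_self_eq_zero_iff _ |>.1 h1
  exact ⟨c, by rw [← hdec, hn0, sub_zero, hc]⟩

lemma pos_of_ract (b : B) (hb : star b = b)
    (h : ∀ x, ∃ a, X.linner (X.ract b x) x = star a * a) : ∃ c, b = star c * c := by
  refine X.dual.pos_of_lact b hb fun x => ?_
  obtain ⟨x, rfl⟩ := X.toDual.surjective x
  obtain ⟨a, ha⟩ := h x
  refine ⟨a, ?_⟩
  rw [← ha]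
  rw [dual_lact, dual_rinner, X.linner_ract]

end EquivalenceBimodule

lemma cspan_induction {E : Type*} [NormedAddCommGroup E] [NormedSpace ℂ E] {s : Set E}
    {P : E → Prop} (hs : ∀ x ∈ s, P x) (h0 : P 0) (hadd : ∀ x y, P x → P y → P (x + y))
    (hsmul : ∀ (c : ℂ) x, P x → P (c • x)) (hcl : IsClosed {x | P x}) {x : E}
    (hx : x ∈ cspan s) : P x :=
  let K : Submodule ℂ E :=
    { carrier := {x | P x}
      zero_mem' := h0
      add_mem' := fun {x y} h k => hadd x y h k
      smul_mem' := fun c x h => hsmul c x h }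
  cspan_le (K := K) hcl hs hx

lemma cspan_subtype {E : Type*} [NormedAddCommGroup E] [NormedSpace ℂ E] (s : Set E) :
    cspan {t : ↥(cspan s) | (t : E) ∈ s} = ⊤ := by
  refine eq_top_iff.2 fun p _ => ?_
  have hcl : IsClosed (((cspan {t : ↥(cspan s) | (t : E) ∈ s}).map (cspan s).subtype :
      Submodule ℂ E) : Set E) :=
    (isClosed_cspan s).isClosedEmbedding_subtypeVal.isClosedMap _
      (isClosed_cspan {t : ↥(cspan s) | (t : E) ∈ s})
  obtain ⟨q, hq, hqp⟩ := cspan_le hcl (fun x hx => ⟨⟨x, subset_cspan hx⟩, subset_cspan hx, rfl⟩) p.2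
  rwa [← Subtype.ext hqp]

section comp

variable {E F G : Type*} [NormedAddCommGroup E] [NormedSpace ℂ E] [NormedAddCommGroup F]
  [NormedSpace ℂ F] [NormedAddCommGroup G] [NormedSpace ℂ G] {σ τ ρ : ℂ →+* ℂ}
  [RingHomCompTriple σ τ ρ] [RingHomIsometric σ] [RingHomIsometric τ] [RingHomIsometric ρ]

lemma continuous_comp_const {α : Type*} [TopologicalSpace α] (S : E →SL[σ] F)
    {T : α → F →SL[τ] G} (hT : Continuous T) : Continuous fun t => (T t).comp S :=
  ((ContinuousLinearMap.compSL E F G σ τ).flip S).continuous.comp hT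

lemma continuous_const_comp {α : Type*} [TopologicalSpace α] (T : F →SL[τ] G)
    {S : α → E →SL[σ] F} (hS : Continuous S) : Continuous fun t => T.comp (S t) :=
  (ContinuousLinearMap.compSL E F G σ τ T).continuous.comp hS

end comp

namespace EquivalenceBimodule

section iso

variable {A B D : Type u} [NonUnitalCStarAlgebra A] [NonUnitalCStarAlgebra B]
  [NonUnitalCStarAlgebra D] {X Y W : EquivalenceBimodule A B}

instance : FunLike (Iso X Y) X Y where
  coe Φ := Φ.toLinearEquiv
  coe_injective Φ Ψ h := by
    obtain ⟨Φ, _, _, _, _⟩ := Φ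
    obtain ⟨Ψ, _, _, _, _⟩ := Ψ
    obtain rfl : Φ = Ψ := LinearEquiv.ext (congrFun h)
    rfl

namespace Iso

lemma coe_toLinearEquiv (Φ : Iso X Y) (x) : Φ.toLinearEquiv x = Φ x := rfl
lemma norm_map (Φ : Iso X Y) (x) : ‖Φ x‖ = ‖x‖ := by
  have := Φ.map_linner x x
  have h := Y.norm_linner (Φ x)
  rw [← pow_left_inj₀ (norm_nonneg _) (norm_nonneg _) two_ne_zero, ← h, ← X.norm_linner]
  exact congrArg _ this
lemma continuous (Φ : Iso X Y) : Continuous Φ :=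
  (LinearIsometry.mk Φ.toLinearEquiv.toLinearMap Φ.norm_map).continuous
lemma lact (Φ : Iso X Y) (a x) : Φ (X.lact a x) = Y.lact a (Φ x) := Φ.map_lact a x
lemma ract (Φ : Iso X Y) (a x) : Φ (X.ract a x) = Y.ract a (Φ x) := Φ.map_ract a x
lemma linner (Φ : Iso X Y) (x y) : Y.linner (Φ x) (Φ y) = X.linner x y := Φ.map_linner x y
lemma rinner (Φ : Iso X Y) (x y) : Y.rinner (Φ x) (Φ y) = X.rinner x y := Φ.map_rinner x y
lemma surjective (Φ : Iso X Y) : Function.Surjective Φ := Φ.toLinearEquiv.surjective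
lemma injective (Φ : Iso X Y) : Function.Injective Φ := Φ.toLinearEquiv.injective

/-- A linear bijection preserving the inner products also preserves the actions. -/
def ofInner (e : X ≃ₗ[ℂ] Y) (hl : ∀ x y, Y.linner (e x) (e y) = X.linner x y)
    (hr : ∀ x y, Y.rinner (e x) (e y) = X.rinner x y) : Iso X Y where
  toLinearEquiv := e
  map_linner := hl
  map_rinner := hr
  map_lact a x := Y.eq_of_linner fun z => by
    obtain ⟨z, rfl⟩ := e.surjective z
    rw [Y.linner_lact]
    change Y.linner (e _) _ = _ * Y.linner (e x) _
    rw [hl, hl, X.linner_lact]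
  map_ract a x := Y.eq_of_rinner fun z => by
    obtain ⟨z, rfl⟩ := e.surjective z
    rw [Y.rinner_ract]
    change Y.rinner _ (e _) = Y.rinner _ (e x) * _
    rw [hr, hr, X.rinner_ract]

def refl (X : EquivalenceBimodule A B) : Iso X X :=
  ofInner (LinearEquiv.refl ℂ X) (fun _ _ => rfl) (fun _ _ => rfl)

def symm (Φ : Iso X Y) : Iso Y X :=
  ofInner Φ.toLinearEquiv.symm
    (fun x y => by
      obtain ⟨x, rfl⟩ := Φ.toLinearEquiv.surjective x
      obtain ⟨y, rfl⟩ := Φ.toLinearEquiv.surjective y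
      simp only [LinearEquiv.symm_apply_apply]
      exact (Φ.linner x y).symm)
    (fun x y => by
      obtain ⟨x, rfl⟩ := Φ.toLinearEquiv.surjective x
      obtain ⟨y, rfl⟩ := Φ.toLinearEquiv.surjective y
      simp only [LinearEquiv.symm_apply_apply]
      exact (Φ.rinner x y).symm)

def trans (Φ : Iso X Y) (Ψ : Iso Y W) : Iso X W :=
  ofInner (Φ.toLinearEquiv.trans Ψ.toLinearEquiv)
    (fun _ _ => (Ψ.linner _ _).trans (Φ.linner _ _))
    (fun _ _ => (Ψ.rinner _ _).trans (Φ.rinner _ _))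

@[simp] lemma refl_apply (x : X) : refl X x = x := rfl
@[simp] lemma trans_apply (Φ : Iso X Y) (Ψ : Iso Y W) (x) : Φ.trans Ψ x = Ψ (Φ x) := rfl
@[simp] lemma symm_apply_apply (Φ : Iso X Y) (x) : Φ.symm (Φ x) = x :=
  Φ.toLinearEquiv.symm_apply_apply x
@[simp] lemma apply_symm_apply (Φ : Iso X Y) (x) : Φ (Φ.symm x) = x :=
  Φ.toLinearEquiv.apply_symm_apply x

end Iso

/-- Two families with dense span and the same inner products are related by an isomorphism. -/
theorem exists_iso {ι : Type*} (f : ι → X) (g : ι → Y) (hf : cspan (Set.range f) = ⊤)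
    (hg : cspan (Set.range g) = ⊤) (hl : ∀ i j, Y.linner (g i) (g j) = X.linner (f i) (f j))
    (hr : ∀ i j, Y.rinner (g i) (g j) = X.rinner (f i) (f j)) :
    ∃ Φ : Iso X Y, ∀ i, Φ (f i) = g i := by
  set F := Finsupp.linearCombination ℂ f with hF
  set G := Finsupp.linearCombination ℂ g with hG
  have dF : DenseRange F := by
    intro x
    have : x ∈ cspan (Set.range f) := by rw [hf]; trivial
    rw [cspan, ← Finsupp.range_linearCombination] at this
    exact this
  have dG : DenseRange G := by
    intro x
    have : x ∈ cspan (Set.range g) := by rw [hg]; trivial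
    rw [cspan, ← Finsupp.range_linearCombination] at this
    exact this
  have il : ∀ c d, Y.linner (G c) (G d) = X.linner (F c) (F d) := by
    intro c d
    induction c using Finsupp.induction_linear with
    | zero => simp
    | add c c' h h' => simp [h, h']
    | single i r =>
      induction d using Finsupp.induction_linear with
      | zero => simp
      | add c c' h h' => simp only [map_add, h, h']
      | single j s => simp [F, G, hl]
  have ir : ∀ c d, Y.rinner (G c) (G d) = X.rinner (F c) (F d) := by
    intro c d
    induction c using Finsupp.induction_linear with
    | zero => simp
    | add c c' h h' => simp [h, h']
    | single i r =>
      induction d using Finsupp.induction_linear with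
      | zero => simp
      | add c c' h h' => simp only [map_add, h, h']
      | single j s => simp [F, G, hr]
  have hn : ∀ c, ‖G c‖ = ‖F c‖ := fun c => by
    rw [← pow_left_inj₀ (norm_nonneg _) (norm_nonneg _) two_ne_zero, ← Y.norm_linner, il,
      X.norm_linner]
  let e : X ≃L[ℂ] Y := LinearEquiv.extend (LinearEquiv.refl ℂ _) F G dF
    ⟨1, fun x => by simp [hn]⟩ dG ⟨1, fun x => by simp [hn]⟩
  have he : ∀ c, e (F c) = G c := fun c => LinearEquiv.extend_eq _ _ _ _ _ _ _ c
  refine ⟨Iso.ofInner e.toLinearEquiv ?_ ?_, fun i => ?_⟩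
  · intro x y
    change Y.linner (e x) (e y) = _
    refine dF.induction_on₂ (p := fun x y => Y.linner (e x) (e y) = X.linner x y)
      (isClosed_eq (Y.continuous_linner (e.continuous.comp continuous_fst)
        (e.continuous.comp continuous_snd)) (X.continuous_linner continuous_fst continuous_snd))
      (fun c d => by rw [he, he, il]) x y
  · intro x y
    change Y.rinner (e x) (e y) = _
    refine dF.induction_on₂ (p := fun x y => Y.rinner (e x) (e y) = X.rinner x y)
      (isClosed_eq (Y.continuous_rinner (e.continuous.comp continuous_fst)
        (e.continuous.comp continuous_snd)) (X.continuous_rinner continuous_fst continuous_snd))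
      (fun c d => by rw [he, he, ir]) x y
  · have := he (Finsupp.single i 1)
    simp only [F, G, Finsupp.linearCombination_single, one_smul] at this
    exact this

end iso

section construction

variable {A B D : Type u} [NonUnitalCStarAlgebra A] [NonUnitalCStarAlgebra B]
  [NonUnitalCStarAlgebra D] (X : EquivalenceBimodule A B) (Z : EquivalenceBimodule B D)

abbrev PairOp : Type u := (X →L⋆[ℂ] Z) × (Z →L⋆[ℂ] X)

/-- The pair of operators `y ↦ ⟨y, x⟩_B · z` and `w ↦ x · ⟨z, w⟩_B`. -/
def rankOne : X →ₗ[ℂ] Z →ₗ[ℂ] PairOp X Z :=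
  LinearMap.mk₂ ℂ (fun x z => ((Z.lactL.flip z).comp (X.rinnerL.flip x),
      (X.ractL.flip x).comp (Z.linnerL z)))
    (fun x x' z => by ext <;> simp) (fun c x z => by ext <;> simp)
    (fun x z z' => by ext <;> simp) (fun c x z => by ext <;> simp)

@[simp] lemma rankOne_fst (x z y) : (rankOne X Z x z).1 y = Z.lact (X.rinner y x) z := rfl
@[simp] lemma rankOne_snd (x z w) : (rankOne X Z x z).2 w = X.ract (Z.linner z w) x := rfl

def tensorSpace : Submodule ℂ (PairOp X Z) := cspan {t | ∃ x z, rankOne X Z x z = t}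

variable {X Z}

lemma tensorSpace_adj {p : PairOp X Z} (hp : p ∈ tensorSpace X Z) (y w) :
    Z.linner (p.1 y) w = X.rinner y (p.2 w) := by
  refine cspan_induction (P := fun p : PairOp X Z => Z.linner (p.1 y) w = X.rinner y (p.2 w))
    ?_ ?_ ?_ ?_ ?_ hp
  · rintro _ ⟨x, z, rfl⟩
    simp [Z.linner_lact, X.rinner_ract]
  · simp
  · intro p q h h'; simp [h, h']
  · intro c p h; simp [h]
  · have h1 : Continuous fun p : PairOp X Z => p.1 y :=
      (ContinuousLinearMap.apply' Z _ y).continuous.comp continuous_fst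
    have h2 : Continuous fun p : PairOp X Z => p.2 w :=
      (ContinuousLinearMap.apply' X _ w).continuous.comp continuous_snd
    exact isClosed_eq (Z.continuous_linner h1 continuous_const)
      (X.continuous_rinner continuous_const h2)

lemma comp_snd_fst_mem {p q : PairOp X Z} (hp : p ∈ tensorSpace X Z) (hq : q ∈ tensorSpace X Z) :
    p.2.comp q.1 ∈ LinearMap.range X.lactL.toLinearMap := by
  refine cspan_induction
    (P := fun p : PairOp X Z => p.2.comp q.1 ∈ LinearMap.range X.lactL.toLinearMap)
    ?_ ?_ ?_ ?_ ?_ hp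
  · rintro _ ⟨x', z', rfl⟩
    refine cspan_induction (P := fun q : PairOp X Z =>
      (rankOne X Z x' z').2.comp q.1 ∈ LinearMap.range X.lactL.toLinearMap) ?_ ?_ ?_ ?_ ?_ hq
    · rintro _ ⟨x, z, rfl⟩
      refine ⟨X.linner (X.ract (Z.linner z' z) x') x, ?_⟩
      ext y
      simp [X.lact_linner, Z.linner_lact_right, X.star_rinner, X.ract_mul]
    · simp
    · intro p q h h'
      simpa [ContinuousLinearMap.comp_add] using add_mem h h'
    · intro c p h
      simpa using Submodule.smul_mem _ (starRingEnd ℂ c) h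
    · exact X.isClosed_range_lactL.preimage (continuous_const_comp _ continuous_fst)
  · simp
  · intro p q h h'
    simpa [ContinuousLinearMap.add_comp] using add_mem h h'
  · intro c p h
    simpa using Submodule.smul_mem _ c h
  · exact X.isClosed_range_lactL.preimage
      (continuous_comp_const _ continuous_snd)

lemma comp_fst_snd_mem {p q : PairOp X Z} (hp : p ∈ tensorSpace X Z) (hq : q ∈ tensorSpace X Z) :
    q.1.comp p.2 ∈ LinearMap.range Z.ractL.toLinearMap := by
  refine cspan_induction
    (P := fun p : PairOp X Z => q.1.comp p.2 ∈ LinearMap.range Z.ractL.toLinearMap)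
    ?_ ?_ ?_ ?_ ?_ hp
  · rintro _ ⟨x', z', rfl⟩
    refine cspan_induction (P := fun q : PairOp X Z =>
      q.1.comp (rankOne X Z x' z').2 ∈ LinearMap.range Z.ractL.toLinearMap) ?_ ?_ ?_ ?_ ?_ hq
    · rintro _ ⟨x, z, rfl⟩
      refine ⟨Z.rinner z' (Z.lact (X.rinner x' x) z), ?_⟩
      ext y
      simp [← Z.lact_linner, X.rinner_ract_left, Z.star_linner, Z.lact_mul]
    · simp
    · intro p q h h'
      simpa [ContinuousLinearMap.add_comp] using add_mem h h'
    · intro c p h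
      simpa using Submodule.smul_mem _ c h
    · exact Z.isClosed_range_ractL.preimage (continuous_comp_const _ continuous_fst)
  · simp
  · intro p q h h'
    simpa [ContinuousLinearMap.comp_add] using add_mem h h'
  · intro c p h
    simpa using Submodule.smul_mem _ (starRingEnd ℂ c) h
  · exact Z.isClosed_range_ractL.preimage
      (continuous_const_comp _ continuous_snd)

def tLinnerAux (p q : tensorSpace X Z) : A := (comp_snd_fst_mem p.2 q.2).choose
def tRinnerAux (p q : tensorSpace X Z) : D := (comp_fst_snd_mem p.2 q.2).choose

lemma tLinnerAux_spec (p q : tensorSpace X Z) (y) :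
    X.lact (tLinnerAux p q) y = p.1.2 (q.1.1 y) :=
  congrArg (fun T : X →L[ℂ] X => T y) (comp_snd_fst_mem p.2 q.2).choose_spec
lemma tRinnerAux_spec (p q : tensorSpace X Z) (w) :
    Z.ract (tRinnerAux p q) w = q.1.1 (p.1.2 w) :=
  congrArg (fun T : Z →L[ℂ] Z => T w) (comp_fst_snd_mem p.2 q.2).choose_spec

def tLinner : tensorSpace X Z →ₗ[ℂ] tensorSpace X Z →ₗ⋆[ℂ] A :=
  LinearMap.mk₂'ₛₗ _ _ tLinnerAux
    (fun p p' q => X.lact_injective fun y => by simp [tLinnerAux_spec])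
    (fun c p q => X.lact_injective fun y => by simp [tLinnerAux_spec])
    (fun p q q' => X.lact_injective fun y => by simp [tLinnerAux_spec])
    (fun c p q => X.lact_injective fun y => by simp [tLinnerAux_spec])

def tRinner : tensorSpace X Z →ₗ⋆[ℂ] tensorSpace X Z →ₗ[ℂ] D :=
  LinearMap.mk₂'ₛₗ _ _ tRinnerAux
    (fun p p' q => Z.ract_injective fun y => by simp [tRinnerAux_spec])
    (fun c p q => Z.ract_injective fun y => by simp [tRinnerAux_spec])
    (fun p q q' => Z.ract_injective fun y => by simp [tRinnerAux_spec])
    (fun c p q => Z.ract_injective fun y => by simp [tRinnerAux_spec])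

lemma tLinner_spec (p q : tensorSpace X Z) (y) :
    X.lact (tLinner p q) y = p.1.2 (q.1.1 y) := tLinnerAux_spec p q y
lemma tRinner_spec (p q : tensorSpace X Z) (w) :
    Z.ract (tRinner p q) w = q.1.1 (p.1.2 w) := tRinnerAux_spec p q w

lemma lactOp_mem (a : A) {p : PairOp X Z} (hp : p ∈ tensorSpace X Z) :
    ((p.1.comp (X.lactL (star a)), (X.lactL a).comp p.2) : PairOp X Z) ∈ tensorSpace X Z := by
  refine cspan_induction (P := fun p : PairOp X Z =>
    ((p.1.comp (X.lactL (star a)), (X.lactL a).comp p.2) : PairOp X Z) ∈ tensorSpace X Z)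
    ?_ ?_ ?_ ?_ ?_ hp
  · rintro _ ⟨x, z, rfl⟩
    refine subset_cspan ⟨X.lact a x, z, ?_⟩
    ext <;> simp [X.rinner_lact, X.lact_ract]
  · convert zero_mem (tensorSpace X Z)
    all_goals (ext; simp)
  · intro p q h h'
    simpa [ContinuousLinearMap.add_comp, ContinuousLinearMap.comp_add] using add_mem h h'
  · intro c p h
    simpa using Submodule.smul_mem _ c h
  · exact (isClosed_cspan _).preimage ((continuous_comp_const _ continuous_fst).prodMk
      (continuous_const_comp _ continuous_snd))

lemma ractOp_mem (d : D) {p : PairOp X Z} (hp : p ∈ tensorSpace X Z) :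
    (((Z.ractL d).comp p.1, p.2.comp (Z.ractL (star d))) : PairOp X Z) ∈ tensorSpace X Z := by
  refine cspan_induction (P := fun p : PairOp X Z =>
    (((Z.ractL d).comp p.1, p.2.comp (Z.ractL (star d))) : PairOp X Z) ∈ tensorSpace X Z)
    ?_ ?_ ?_ ?_ ?_ hp
  · rintro _ ⟨x, z, rfl⟩
    refine subset_cspan ⟨x, Z.ract d z, ?_⟩
    ext <;> simp [Z.linner_ract, Z.lact_ract]
  · convert zero_mem (tensorSpace X Z)
    all_goals (ext; simp)
  · intro p q h h'
    simpa [ContinuousLinearMap.add_comp, ContinuousLinearMap.comp_add] using add_mem h h'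
  · intro c p h
    simpa using Submodule.smul_mem _ c h
  · exact (isClosed_cspan _).preimage ((continuous_const_comp _ continuous_fst).prodMk
      (continuous_comp_const _ continuous_snd))

lemma tensor_ext {p q : tensorSpace X Z} (h1 : ∀ y, p.1.1 y = q.1.1 y)
    (h2 : ∀ w, p.1.2 w = q.1.2 w) : p = q :=
  Subtype.ext (Prod.ext (ContinuousLinearMap.ext h1) (ContinuousLinearMap.ext h2))

def tLact : A →ₗ[ℂ] tensorSpace X Z →ₗ[ℂ] tensorSpace X Z :=
  LinearMap.mk₂ ℂ (fun a p => ⟨_, lactOp_mem a p.2⟩)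
    (fun a a' p => tensor_ext
      (fun y => show p.1.1 (X.lact (star (a + a')) y) =
          p.1.1 (X.lact (star a) y) + p.1.1 (X.lact (star a') y) by
        rw [star_add, map_add, LinearMap.add_apply, map_add])
      (fun w => show X.lact (a + a') (p.1.2 w) = X.lact a (p.1.2 w) + X.lact a' (p.1.2 w) by
        rw [map_add, LinearMap.add_apply]))
    (fun c a p => tensor_ext
      (fun y => show p.1.1 (X.lact (star (c • a)) y) = c • p.1.1 (X.lact (star a) y) by
        rw [star_smul, map_smul, LinearMap.smul_apply, map_smulₛₗ]; simp)
      (fun w => show X.lact (c • a) (p.1.2 w) = c • X.lact a (p.1.2 w) by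
        rw [map_smul, LinearMap.smul_apply]))
    (fun a p q => tensor_ext (fun y => rfl)
      (fun w => show X.lact a (p.1.2 w + q.1.2 w) = _ from map_add _ _ _))
    (fun c a p => tensor_ext (fun y => rfl)
      (fun w => show X.lact a (c • p.1.2 w) = _ from map_smul _ _ _))

def tRact : D →ₗ[ℂ] tensorSpace X Z →ₗ[ℂ] tensorSpace X Z :=
  LinearMap.mk₂ ℂ (fun a p => ⟨_, ractOp_mem a p.2⟩)
    (fun a a' p => tensor_ext
      (fun w => show Z.ract (a + a') (p.1.1 w) = Z.ract a (p.1.1 w) + Z.ract a' (p.1.1 w) by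
        rw [map_add, LinearMap.add_apply])
      (fun y => show p.1.2 (Z.ract (star (a + a')) y) =
          p.1.2 (Z.ract (star a) y) + p.1.2 (Z.ract (star a') y) by
        rw [star_add, map_add, LinearMap.add_apply, map_add]))
    (fun c a p => tensor_ext
      (fun w => show Z.ract (c • a) (p.1.1 w) = c • Z.ract a (p.1.1 w) by
        rw [map_smul, LinearMap.smul_apply])
      (fun y => show p.1.2 (Z.ract (star (c • a)) y) = c • p.1.2 (Z.ract (star a) y) by
        rw [star_smul, map_smul, LinearMap.smul_apply, map_smulₛₗ]; simp))
    (fun a p q => tensor_ext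
      (fun w => show Z.ract a (p.1.1 w + q.1.1 w) = _ from map_add _ _ _) (fun y => rfl))
    (fun c a p => tensor_ext
      (fun w => show Z.ract a (c • p.1.1 w) = _ from map_smul _ _ _) (fun y => rfl))

@[simp] lemma tLact_fst (a : A) (p : tensorSpace X Z) (y) :
    (tLact a p).1.1 y = p.1.1 (X.lact (star a) y) := rfl
@[simp] lemma tLact_snd (a : A) (p : tensorSpace X Z) (y) :
    (tLact a p).1.2 y = X.lact a (p.1.2 y) := rfl
@[simp] lemma tRact_fst (a : D) (p : tensorSpace X Z) (y) :
    (tRact a p).1.1 y = Z.ract a (p.1.1 y) := rfl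
@[simp] lemma tRact_snd (a : D) (p : tensorSpace X Z) (y) :
    (tRact a p).1.2 y = p.1.2 (Z.ract (star a) y) := rfl

lemma tstar_linner (p q : tensorSpace X Z) : star (tLinner p q) = tLinner q p :=
  X.lact_injective fun y => X.eq_of_rinner fun z => by
    rw [← X.rinner_lact, tLinner_spec, tLinner_spec, ← tensorSpace_adj q.2, ← X.star_rinner,
      ← tensorSpace_adj p.2, Z.star_linner]

lemma tstar_rinner (p q : tensorSpace X Z) : star (tRinner p q) = tRinner q p :=
  Z.ract_injective fun y => Z.eq_of_linner fun z => by
    rw [Z.linner_ract, star_star, tRinner_spec, tRinner_spec, ← Z.star_linner,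
      tensorSpace_adj q.2, tensorSpace_adj p.2, X.star_rinner]

lemma tnorm_aux (p : tensorSpace X Z) : ‖p.1.1‖ = ‖p.1.2‖ ∧ ‖p‖ = ‖p.1.1‖ ∧
    ‖p.1.1‖ ^ 2 ≤ ‖tLinner p p‖ ∧ ‖p.1.2‖ ^ 2 ≤ ‖tRinner p p‖ := by
  have key1 (y) : ‖p.1.1 y‖ ^ 2 = ‖X.rinner y (p.1.2 (p.1.1 y))‖ := by
    rw [← tensorSpace_adj p.2, Z.norm_linner]
  have key2 (w) : ‖p.1.2 w‖ ^ 2 = ‖Z.linner (p.1.1 (p.1.2 w)) w‖ := by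
    rw [tensorSpace_adj p.2, X.norm_rinner]
  have gen {E F : Type u} [NormedAddCommGroup E] [NormedSpace ℂ E] [NormedAddCommGroup F]
      [NormedSpace ℂ F] (S : E →L⋆[ℂ] F) (c : ℝ) (hc : 0 ≤ c)
      (h : ∀ y, ‖S y‖ ^ 2 ≤ c * ‖y‖ ^ 2) : ‖S‖ ^ 2 ≤ c := by
    have : ‖S‖ ≤ √c := S.opNorm_le_bound (by positivity) fun y => by
      rw [← pow_le_pow_iff_left₀ (by positivity) (by positivity) two_ne_zero, mul_pow,
        Real.sq_sqrt hc]
      exact h y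
    calc _ ≤ √c ^ 2 := by gcongr
      _ = c := Real.sq_sqrt hc
  have a1 : ‖p.1.1‖ ^ 2 ≤ ‖tLinner p p‖ := gen _ _ (norm_nonneg _) fun y => by
    rw [key1, ← tLinner_spec]
    calc _ ≤ ‖y‖ * (‖tLinner p p‖ * ‖y‖) :=
          (X.norm_rinner_le _ _).trans (by gcongr; exact X.norm_lact_le _ _)
      _ = _ := by ring
  have a2 : ‖p.1.2‖ ^ 2 ≤ ‖tRinner p p‖ := gen _ _ (norm_nonneg _) fun w => by
    rw [key2, ← tRinner_spec]
    calc _ ≤ (‖tRinner p p‖ * ‖w‖) * ‖w‖ :=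
          (Z.norm_linner_le _ _).trans (by gcongr; exact Z.norm_ract_le _ _)
      _ = _ := by ring
  have b1 : ‖p.1.1‖ ^ 2 ≤ ‖p.1.2‖ * ‖p.1.1‖ := gen _ _ (by positivity) fun y => by
    rw [key1]
    calc _ ≤ ‖y‖ * (‖p.1.2‖ * (‖p.1.1‖ * ‖y‖)) := by
          refine (X.norm_rinner_le _ _).trans ?_
          gcongr
          exact (p.1.2.le_opNorm _).trans (by gcongr; exact p.1.1.le_opNorm _)
      _ = _ := by ring
  have b2 : ‖p.1.2‖ ^ 2 ≤ ‖p.1.1‖ * ‖p.1.2‖ := gen _ _ (by positivity) fun w => by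
    rw [key2]
    calc _ ≤ (‖p.1.1‖ * (‖p.1.2‖ * ‖w‖)) * ‖w‖ := by
          refine (Z.norm_linner_le _ _).trans ?_
          gcongr
          exact (p.1.1.le_opNorm _).trans (by gcongr; exact p.1.2.le_opNorm _)
      _ = _ := by ring
  have e : ‖p.1.1‖ = ‖p.1.2‖ := by
    have := norm_nonneg p.1.1
    have := norm_nonneg p.1.2
    apply le_antisymm <;> by_contra! h <;> nlinarith
  refine ⟨e, ?_, a1, a2⟩
  change max ‖p.1.1‖ ‖p.1.2‖ = _
  rw [← e, max_self]

lemma tnorm_linner (p : tensorSpace X Z) : ‖tLinner p p‖ = ‖p‖ ^ 2 := by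
  obtain ⟨h1, h2, h3, h4⟩ := tnorm_aux p
  rw [h2]
  refine le_antisymm (X.norm_le_of_lact _ _ (by positivity) fun y => ?_) h3
  rw [tLinner_spec]
  calc _ ≤ ‖p.1.2‖ * (‖p.1.1‖ * ‖y‖) :=
        (p.1.2.le_opNorm _).trans (by gcongr; exact p.1.1.le_opNorm _)
    _ = _ := by rw [← h1]; ring

lemma tnorm_rinner (p : tensorSpace X Z) : ‖tRinner p p‖ = ‖p‖ ^ 2 := by
  obtain ⟨h1, h2, h3, h4⟩ := tnorm_aux p
  rw [h2, h1]
  refine le_antisymm (Z.norm_le_of_ract _ _ (by positivity) fun y => ?_) h4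
  rw [tRinner_spec]
  calc _ ≤ ‖p.1.1‖ * (‖p.1.2‖ * ‖y‖) :=
        (p.1.1.le_opNorm _).trans (by gcongr; exact p.1.2.le_opNorm _)
    _ = _ := by rw [h1]; ring

variable (X Z) in
def elem (x : X) (z : Z) : tensorSpace X Z := ⟨rankOne X Z x z, subset_cspan ⟨x, z, rfl⟩⟩

lemma tLinner_elem (x : X) (z : Z) (x' : X) (z' : Z) :
    tLinner (elem X Z x z) (elem X Z x' z') = X.linner (X.ract (Z.linner z z') x) x' :=
  X.lact_injective fun y => by
    simp [elem, tLinner_spec, X.lact_linner, Z.linner_lact_right, X.star_rinner, X.ract_mul]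

lemma tRinner_elem (x : X) (z : Z) (x' : X) (z' : Z) :
    tRinner (elem X Z x z) (elem X Z x' z') = Z.rinner z (Z.lact (X.rinner x x') z') :=
  Z.ract_injective fun y => by
    simp [elem, tRinner_spec, ← Z.lact_linner, X.rinner_ract_left, Z.star_linner, Z.lact_mul]

lemma tLinner_full : cspan {a | ∃ p q : tensorSpace X Z, tLinner p q = a} = ⊤ := by
  set K := cspan {a | ∃ p q : tensorSpace X Z, tLinner p q = a}
  have hK : IsClosed (K : Set A) := isClosed_cspan _
  have h1 (x x' : X) (b : B) : X.linner (X.ract b x) x' ∈ K := by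
    refine cspan_map_top Z.linner_full ((X.linner.flip x').comp (X.ract.flip x))
      (show Continuous fun b => X.linner (X.ract b x) x' by fun_prop) hK ?_ b
    rintro _ ⟨z, z', rfl⟩
    exact subset_cspan ⟨elem X Z x z, elem X Z x' z', tLinner_elem x z x' z'⟩
  refine eq_top_iff.2 fun a _ => cspan_eq_top_of X.linner_full hK ?_ a
  rintro _ ⟨x, x', rfl⟩
  exact X.mem_of_ract_mem ⊤ isClosed_univ x trivial {x | X.linner x x' ∈ K}
    (hK.preimage (by fun_prop)) fun b _ => h1 x x' b

lemma tRinner_full : cspan {a | ∃ p q : tensorSpace X Z, tRinner p q = a} = ⊤ := by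
  set K := cspan {a | ∃ p q : tensorSpace X Z, tRinner p q = a}
  have hK : IsClosed (K : Set D) := isClosed_cspan _
  have h1 (z z' : Z) (b : B) : Z.rinner z (Z.lact b z') ∈ K := by
    refine cspan_map_top X.rinner_full ((Z.rinner z).comp (Z.lact.flip z'))
      (show Continuous fun b => Z.rinner z (Z.lact b z') by fun_prop) hK ?_ b
    rintro _ ⟨x, x', rfl⟩
    exact subset_cspan ⟨elem X Z x z, elem X Z x' z', tRinner_elem x z x' z'⟩
  refine eq_top_iff.2 fun a _ => cspan_eq_top_of Z.rinner_full hK ?_ a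
  rintro _ ⟨z, z', rfl⟩
  exact Z.mem_of_lact_mem ⊤ isClosed_univ z' trivial {z' | Z.rinner z z' ∈ K}
    (hK.preimage (by fun_prop)) fun b _ => h1 z z' b

lemma tlinner_lact (a : A) (p q : tensorSpace X Z) : tLinner (tLact a p) q = a * tLinner p q :=
  X.lact_injective fun y => by rw [tLinner_spec, X.lact_mul, tLinner_spec, tLact_snd]
lemma trinner_ract (d : D) (p q : tensorSpace X Z) : tRinner p (tRact d q) = tRinner p q * d :=
  Z.ract_injective fun y => by rw [tRinner_spec, Z.ract_mul, tRinner_spec, tRact_fst]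
lemma tlinner_ract (d : D) (p q : tensorSpace X Z) :
    tLinner (tRact d p) q = tLinner p (tRact (star d) q) :=
  X.lact_injective fun y => by rw [tLinner_spec, tLinner_spec, tRact_snd, tRact_fst]
lemma trinner_lact (a : A) (p q : tensorSpace X Z) :
    tRinner (tLact a p) q = tRinner p (tLact (star a) q) :=
  Z.ract_injective fun y => by
    rw [tRinner_spec, tRinner_spec, tLact_snd, tLact_fst, star_star]
lemma tlact_linner (p q r : tensorSpace X Z) : tLact (tLinner p q) r = tRact (tRinner q r) p := by
  refine tensor_ext (fun y => ?_) (fun w => ?_)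
  · rw [tLact_fst, tRact_fst, tRinner_spec, tstar_linner, tLinner_spec]
  · rw [tLact_snd, tRact_snd, tLinner_spec, tstar_rinner, tRinner_spec]
attribute [irreducible] tLinner tRinner tLact tRact

lemma tlact_mul (a a' : A) (p : tensorSpace X Z) : tLact (a * a') p = tLact a (tLact a' p) :=
  tensor_ext (by simp [X.lact_mul]) (by simp [X.lact_mul])
lemma tract_mul (a a' : D) (p : tensorSpace X Z) : tRact (a * a') p = tRact a' (tRact a p) :=
  tensor_ext (by simp [Z.ract_mul]) (by simp [Z.ract_mul])
lemma tlact_ract (a : A) (d : D) (p : tensorSpace X Z) :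
    tLact a (tRact d p) = tRact d (tLact a p) :=
  tensor_ext (by simp) (by simp)
lemma tlinner_pos (p : tensorSpace X Z) : ∃ a, tLinner p p = star a * a :=
  X.pos_of_lact _ (tstar_linner p p) fun y => by
    rw [tLinner_spec, ← tensorSpace_adj p.2]
    exact Z.linner_pos _
lemma trinner_pos (p : tensorSpace X Z) : ∃ a, tRinner p p = star a * a :=
  Z.pos_of_ract _ (tstar_rinner p p) fun w => by
    rw [tRinner_spec, tensorSpace_adj p.2]
    exact X.rinner_pos _

variable (X Z) in
def elemL : X →ₗ[ℂ] Z →ₗ[ℂ] tensorSpace X Z :=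
  LinearMap.mk₂ ℂ (elem X Z)
    (fun _ _ _ => Subtype.ext (by simp [elem])) (fun _ _ _ => Subtype.ext (by simp [elem]))
    (fun _ _ _ => Subtype.ext (by simp [elem])) (fun _ _ _ => Subtype.ext (by simp [elem]))

lemma elem_balanced (b : B) (x : X) (z : Z) : elem X Z (X.ract b x) z = elem X Z x (Z.lact b z) :=
  tensor_ext (fun y => by simp [elem, X.rinner_ract, Z.lact_mul])
    (fun w => by simp [elem, Z.linner_lact, X.ract_mul])
lemma lact_elem (a : A) (x : X) (z : Z) : tLact a (elem X Z x z) = elem X Z (X.lact a x) z :=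
  tensor_ext (fun y => by simp [elem, X.rinner_lact]) (fun w => by simp [elem, X.lact_ract])
lemma ract_elem (d : D) (x : X) (z : Z) : tRact d (elem X Z x z) = elem X Z x (Z.ract d z) :=
  tensor_ext (fun y => by simp [elem, Z.lact_ract]) (fun w => by simp [elem, Z.linner_ract])

variable (X Z) in
/-- A model of `X ⊗_B Z` inside a space of pairs of operators. -/
def tensorModel : EquivalenceBimodule A D where
  carrier := tensorSpace X Z
  normedAddCommGroup := Submodule.normedAddCommGroup _
  normedSpace := Submodule.normedSpace _
  completeSpace := (isClosed_cspan _).completeSpace_coe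
  lact := tLact
  ract := tRact
  linner := tLinner
  rinner := tRinner
  lact_mul a a' p := tlact_mul a a' p
  ract_mul a a' p := tract_mul a a' p
  lact_ract a d p := tlact_ract a d p
  linner_lact a p q := tlinner_lact a p q
  rinner_ract d p q := trinner_ract d p q
  star_linner p q := tstar_linner p q
  star_rinner p q := tstar_rinner p q
  linner_pos p := tlinner_pos p
  rinner_pos p := trinner_pos p
  norm_linner p := tnorm_linner p
  norm_rinner p := tnorm_rinner p
  linner_ract d p q := tlinner_ract d p q
  rinner_lact a p q := trinner_lact a p q
  linner_full := by
    have h := tLinner_full (X := X) (Z := Z)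
    rw [← h]
  rinner_full := by
    have h := tRinner_full (X := X) (Z := Z)
    rw [← h]
  lact_linner p q r := tlact_linner p q r

variable (X Z) in
theorem exists_isTensorProduct : ∃ (T : EquivalenceBimodule A D) (τ : X →ₗ[ℂ] Z →ₗ[ℂ] T),
    IsTensorProduct X Z T τ := by
  refine ⟨tensorModel X Z, elemL X Z,
    ⟨?_, ?_, ?_, ?_, ?_, ?_⟩⟩
  · exact fun b x z => elem_balanced b x z
  · exact fun a x z => lact_elem a x z
  · exact fun d x z => ract_elem d x z
  · exact tLinner_elem
  · exact tRinner_elem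
  · refine (congrArg cspan ?_).trans (cspan_subtype {t | ∃ x z, rankOne X Z x z = t})
    ext t
    exact ⟨fun ⟨x, z, h⟩ => ⟨x, z, congrArg Subtype.val h⟩,
      fun ⟨x, z, h⟩ => ⟨x, z, Subtype.ext h⟩⟩

end construction

end EquivalenceBimodule

/-! Tensor products, the Picard group, and the Picard group of an inclusion. -/

namespace EquivalenceBimodule

section tensor

variable {A B D E : Type u} [NonUnitalCStarAlgebra A] [NonUnitalCStarAlgebra B]
  [NonUnitalCStarAlgebra D] [NonUnitalCStarAlgebra E]

/-- The tensor product `X ⊗_B Z`; it is unique up to isomorphism. -/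
def tensor (X : EquivalenceBimodule A B) (Z : EquivalenceBimodule B D) : EquivalenceBimodule A D :=
  (exists_isTensorProduct X Z).choose

/-- The map `(x, z) ↦ x ⊗ z`. -/
def tmul (X : EquivalenceBimodule A B) (Z : EquivalenceBimodule B D) :
    X →ₗ[ℂ] Z →ₗ[ℂ] tensor X Z :=
  (exists_isTensorProduct X Z).choose_spec.choose

lemma isTensorProduct_tensor (X : EquivalenceBimodule A B) (Z : EquivalenceBimodule B D) :
    IsTensorProduct X Z (tensor X Z) (tmul X Z) :=
  (exists_isTensorProduct X Z).choose_spec.choose_spec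

namespace IsTensorProduct

variable {X X' : EquivalenceBimodule A B} {Z Z' : EquivalenceBimodule B D}
  {T T' : EquivalenceBimodule A D} {τ : X →ₗ[ℂ] Z →ₗ[ℂ] T} {τ' : X' →ₗ[ℂ] Z' →ₗ[ℂ] T'}

lemma norm_le (h : IsTensorProduct X Z T τ) (x z) : ‖τ x z‖ ≤ ‖x‖ * ‖z‖ := by
  refine (pow_le_pow_iff_left₀ (norm_nonneg _) (by positivity) two_ne_zero).1 ?_
  rw [← T.norm_linner, h.linner]
  calc _ ≤ ((‖z‖ * ‖z‖) * ‖x‖) * ‖x‖ := by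
        refine (X.norm_linner_le _ _).trans ?_
        gcongr
        refine (X.norm_ract_le _ _).trans ?_
        gcongr
        exact Z.norm_linner_le _ _
    _ = _ := by ring

lemma continuous (h : IsTensorProduct X Z T τ) {α : Type*} [TopologicalSpace α] {f : α → X}
    {g : α → Z} (hf : Continuous f) (hg : Continuous g) : Continuous fun t => τ (f t) (g t) := by
  let L := τ.mkContinuous₂ 1 (by simpa using h.norm_le)
  exact (L.continuous.comp hf).clm_apply hg

theorem exists_iso_of_iso (h : IsTensorProduct X Z T τ) (h' : IsTensorProduct X' Z' T' τ')
    (Φ : Iso X X') (Ψ : Iso Z Z') : ∃ Θ : Iso T T', ∀ x z, Θ (τ x z) = τ' (Φ x) (Ψ z) := by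
  suffices H : ∃ Θ : Iso T T', ∀ p : X × Z, Θ (τ p.1 p.2) = τ' (Φ p.1) (Ψ p.2) by
    obtain ⟨Θ, hΘ⟩ := H
    exact ⟨Θ, fun x z => hΘ (x, z)⟩
  refine exists_iso (X := T) (Y := T') (fun p : X × Z => τ p.1 p.2)
    (fun p => τ' (Φ p.1) (Ψ p.2)) ?_ ?_ ?_ ?_
  · rw [← h.dense]
    congr 1
    ext t
    simp
  · rw [← h'.dense]
    congr 1
    ext t
    simp only [Set.mem_range, Prod.exists, Set.mem_ofPred_eq]
    constructor
    · rintro ⟨x, z, rfl⟩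
      exact ⟨_, _, rfl⟩
    · rintro ⟨x, z, rfl⟩
      obtain ⟨x, rfl⟩ := Φ.surjective x
      obtain ⟨z, rfl⟩ := Ψ.surjective z
      exact ⟨_, _, rfl⟩
  · intro i j
    rw [h.linner, h'.linner, Ψ.linner, ← Φ.ract, Φ.linner]
  · intro i j
    rw [h.rinner, h'.rinner, Φ.rinner, ← Ψ.lact, Ψ.rinner]

theorem exists_assoc {W : EquivalenceBimodule D E} {T₂ : EquivalenceBimodule B E}
    {S₁ S₂ : EquivalenceBimodule A E} {τ₂ : Z →ₗ[ℂ] W →ₗ[ℂ] T₂} {σ₁ : T →ₗ[ℂ] W →ₗ[ℂ] S₁}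
    {σ₂ : X →ₗ[ℂ] T₂ →ₗ[ℂ] S₂} (h : IsTensorProduct X Z T τ) (h₂ : IsTensorProduct Z W T₂ τ₂)
    (k₁ : IsTensorProduct T W S₁ σ₁) (k₂ : IsTensorProduct X T₂ S₂ σ₂) :
    ∃ Θ : Iso S₁ S₂, ∀ x z w, Θ (σ₁ (τ x z) w) = σ₂ x (τ₂ z w) := by
  suffices H : ∃ Θ : Iso S₁ S₂, ∀ p : X × Z × W,
      Θ (σ₁ (τ p.1 p.2.1) p.2.2) = σ₂ p.1 (τ₂ p.2.1 p.2.2) by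
    obtain ⟨Θ, hΘ⟩ := H
    exact ⟨Θ, fun x z w => hΘ (x, z, w)⟩
  refine exists_iso (X := S₁) (Y := S₂) (fun p : X × Z × W => σ₁ (τ p.1 p.2.1) p.2.2)
    (fun p => σ₂ p.1 (τ₂ p.2.1 p.2.2)) ?_ ?_ ?_ ?_
  · refine eq_top_iff.2 fun s _ => cspan_eq_top_of k₁.dense (isClosed_cspan _) ?_ s
    rintro _ ⟨t, w, rfl⟩
    refine cspan_map_top h.dense (σ₁.flip w) (k₁.continuous continuous_id continuous_const)
      (isClosed_cspan _) ?_ t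
    rintro _ ⟨x, z, rfl⟩
    exact subset_cspan ⟨(x, z, w), rfl⟩
  · refine eq_top_iff.2 fun s _ => cspan_eq_top_of k₂.dense (isClosed_cspan _) ?_ s
    rintro _ ⟨x, t, rfl⟩
    refine cspan_map_top h₂.dense (σ₂ x) (k₂.continuous continuous_const continuous_id)
      (isClosed_cspan _) ?_ t
    rintro _ ⟨z, w, rfl⟩
    exact subset_cspan ⟨(x, z, w), rfl⟩
  · intro i j
    rw [k₁.linner, k₂.linner, h.ract, h.linner, h₂.linner]
  · intro i j
    rw [k₁.rinner, k₂.rinner, h₂.lact, h.rinner, h₂.rinner]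

end IsTensorProduct

end tensor

section self

variable {A B : Type u} [NonUnitalCStarAlgebra A] [NonUnitalCStarAlgebra B]

lemma mem_of_mul_mem (S : NonUnitalStarSubalgebra ℂ A) (hS : IsClosed (S : Set A)) {a : A}
    (ha : a ∈ S) {K : Set A} (hK : IsClosed K) (h : ∀ e ∈ S, a * e ∈ K) : a ∈ K := by
  rw [← hK.closure_eq, Metric.mem_closure_iff]
  intro ε hε
  obtain ⟨e, he, he1, heε⟩ := exists_approx S hS a ha ε hε
  exact ⟨_, h e he, by rwa [dist_eq_norm]⟩

variable (A) in
/-- `A` as an `A`-`A`-equivalence bimodule, with `⟨x, y⟩ = x y*` on the left and `⟨x, y⟩ = x* y` on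
the right. -/
def self : EquivalenceBimodule A A where
  carrier := A
  lact := LinearMap.mul ℂ A
  ract := (LinearMap.mul ℂ A).flip
  linner := LinearMap.mk₂'ₛₗ _ _ (fun x y => x * star y) (by simp [add_mul])
    (by simp [smul_mul_assoc]) (by simp [mul_add]) (by simp [mul_smul_comm])
  rinner := LinearMap.mk₂'ₛₗ _ _ (fun x y => star x * y) (by simp [add_mul])
    (by simp [smul_mul_assoc]) (by simp [mul_add]) (by simp [mul_smul_comm])
  lact_mul a a' x := by simp [mul_assoc]
  ract_mul a a' x := by simp [mul_assoc]
  lact_ract a b x := by simp [mul_assoc]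
  linner_lact a x y := by simp [mul_assoc]
  rinner_ract a x y := by simp [mul_assoc]
  star_linner x y := by simp
  star_rinner x y := by simp
  linner_pos x := ⟨star x, by simp⟩
  rinner_pos x := ⟨x, rfl⟩
  norm_linner x := by simp [CStarRing.norm_self_mul_star, pow_two]
  norm_rinner x := by simp [CStarRing.norm_star_mul_self, pow_two]
  linner_ract b x y := by simp [mul_assoc]
  rinner_lact b x y := by simp [mul_assoc]
  linner_full := eq_top_iff.2 fun a _ => mem_of_mul_mem ⊤ isClosed_univ (a := a) trivial
    (isClosed_cspan _) fun e _ => subset_cspan ⟨a, star e, by simp⟩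
  rinner_full := eq_top_iff.2 fun a _ => mem_of_mul_mem ⊤ isClosed_univ (a := a) trivial
    (isClosed_cspan _) fun e _ => subset_cspan ⟨star a, e, by simp⟩
  lact_linner x y z := by simp [mul_assoc]

variable (A) in
/-- The identity map of `A` onto the bimodule `A`. -/
def toSelf : A ≃ₗ[ℂ] self A := LinearEquiv.refl ℂ A

lemma self_lact (a x : A) : (self A).lact a (toSelf A x) = toSelf A (a * x) := rfl
lemma self_ract (a x : A) : (self A).ract a (toSelf A x) = toSelf A (x * a) := rfl
lemma self_linner (x y : A) : (self A).linner (toSelf A x) (toSelf A y) = x * star y := rfl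
lemma self_rinner (x y : A) : (self A).rinner (toSelf A x) (toSelf A y) = star x * y := rfl

/-- The map `(a, x) ↦ a · x`. -/
def selfMul (X : EquivalenceBimodule A B) : self A →ₗ[ℂ] X →ₗ[ℂ] X :=
  X.lact.comp (toSelf A).symm.toLinearMap

lemma selfMul_apply (X : EquivalenceBimodule A B) (a x) :
    X.selfMul (toSelf A a) x = X.lact a x := rfl

/-- The map `(ỹ, x) ↦ ⟨y, x⟩_B`. -/
def dualMul (X : EquivalenceBimodule A B) : X.dual →ₗ[ℂ] X →ₗ[ℂ] self B :=
  LinearMap.mk₂ ℂ (fun y x => toSelf B (X.rinner (X.toDual.symm y) x))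
    (fun y y' x => by rw [map_add, map_add, LinearMap.add_apply, map_add])
    (fun c y x => by
      rw [map_smulₛₗ X.toDual.symm, map_smulₛₗ X.rinner, LinearMap.smul_apply, map_smul]; simp)
    (by simp) (by simp)

lemma dualMul_apply (X : EquivalenceBimodule A B) (y x) :
    X.dualMul (X.toDual y) x = toSelf B (X.rinner y x) := rfl

lemma isTensorProduct_self (X : EquivalenceBimodule A B) :
    IsTensorProduct (self A) X X X.selfMul where
  balanced b x z := by
    obtain ⟨x, rfl⟩ := (toSelf A).surjective x
    rw [self_ract, selfMul_apply, selfMul_apply, X.lact_mul]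
  lact a x z := by
    obtain ⟨x, rfl⟩ := (toSelf A).surjective x
    rw [self_lact, selfMul_apply, selfMul_apply, X.lact_mul]
  ract d x z := by
    obtain ⟨x, rfl⟩ := (toSelf A).surjective x
    rw [selfMul_apply, selfMul_apply, X.lact_ract]
  linner x z x' z' := by
    obtain ⟨x, rfl⟩ := (toSelf A).surjective x
    obtain ⟨x', rfl⟩ := (toSelf A).surjective x'
    rw [self_ract, selfMul_apply, selfMul_apply, self_linner, X.linner_lact, X.linner_lact_right,
      mul_assoc]
  rinner x z x' z' := by
    obtain ⟨x, rfl⟩ := (toSelf A).surjective x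
    obtain ⟨x', rfl⟩ := (toSelf A).surjective x'
    rw [selfMul_apply, selfMul_apply, self_rinner, X.rinner_lact, X.lact_mul]
  dense := eq_top_iff.2 fun x _ => X.mem_of_lact_mem ⊤ isClosed_univ x trivial _
    (isClosed_cspan _) fun e _ => subset_cspan ⟨toSelf A e, x, rfl⟩

lemma isTensorProduct_dual (X : EquivalenceBimodule A B) :
    IsTensorProduct X.dual X (self B) X.dualMul where
  balanced b y z := by
    obtain ⟨y, rfl⟩ := X.toDual.surjective y
    rw [dual_ract, dualMul_apply, dualMul_apply, X.rinner_lact, star_star]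
  lact a y z := by
    obtain ⟨y, rfl⟩ := X.toDual.surjective y
    rw [dual_lact, dualMul_apply, dualMul_apply, X.rinner_ract_left, star_star, self_lact]
  ract d y z := by
    obtain ⟨y, rfl⟩ := X.toDual.surjective y
    rw [dualMul_apply, dualMul_apply, X.rinner_ract, self_ract]
  linner y x y' x' := by
    obtain ⟨y, rfl⟩ := X.toDual.surjective y
    obtain ⟨y', rfl⟩ := X.toDual.surjective y'
    rw [dualMul_apply, dualMul_apply, self_linner, dual_ract, dual_linner, X.star_linner,
      X.lact_linner, X.rinner_ract_left, X.star_rinner, X.star_rinner]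
  rinner y x y' x' := by
    obtain ⟨y, rfl⟩ := X.toDual.surjective y
    obtain ⟨y', rfl⟩ := X.toDual.surjective y'
    rw [dualMul_apply, dualMul_apply, self_rinner, dual_rinner, X.lact_linner, X.rinner_ract,
      X.star_rinner]
  dense := by
    rw [eq_top_iff]
    intro b _
    have h : (toSelf B).symm b ∈ cspan {b | ∃ x y, X.rinner x y = b} := by
      rw [X.rinner_full]; trivial
    refine cspan_map (toSelf B).toLinearMap continuous_id (isClosed_cspan _) ?_ h
    rintro _ ⟨y, x, rfl⟩
    exact subset_cspan ⟨X.toDual y, x, rfl⟩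

/-- The dual of an isomorphism. -/
lemma exists_dual_iso {X Y : EquivalenceBimodule A B} (Φ : Iso X Y) :
    ∃ Ψ : Iso X.dual Y.dual, ∀ x, Ψ (X.toDual x) = Y.toDual (Φ x) := by
  refine ⟨Iso.ofInner ((X.toDual.symm.trans Φ.toLinearEquiv).trans Y.toDual) ?_ ?_, ?_⟩
  · intro x y
    exact Φ.rinner _ _
  · intro x y
    exact Φ.linner _ _
  · intro x
    rfl

end self

/-- Isomorphism of `A`-`A`-equivalence bimodules. -/
instance setoid (A : Type u) [NonUnitalCStarAlgebra A] : Setoid (EquivalenceBimodule A A) where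
  r X Y := Nonempty (Iso X Y)
  iseqv := ⟨fun X => ⟨Iso.refl X⟩, fun ⟨Φ⟩ => ⟨Φ.symm⟩, fun ⟨Φ⟩ ⟨Ψ⟩ => ⟨Φ.trans Ψ⟩⟩

end EquivalenceBimodule

open EquivalenceBimodule in
/-- The Picard group of a C*-algebra: isomorphism classes of `A`-`A`-equivalence bimodules. -/
def PicardGroup (A : Type u) [NonUnitalCStarAlgebra A] : Type (u + 1) :=
  Quotient (EquivalenceBimodule.setoid A)

namespace PicardGroup

open EquivalenceBimodule

variable {A : Type u} [NonUnitalCStarAlgebra A]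

/-- The class `[X]`. -/
def mk (X : EquivalenceBimodule A A) : PicardGroup A := Quotient.mk _ X

lemma mk_eq_mk {X Y : EquivalenceBimodule A A} : mk X = mk Y ↔ Nonempty (Iso X Y) := Quotient.eq

instance : Mul (PicardGroup A) :=
  ⟨Quotient.map₂ tensor fun X X' ⟨Φ⟩ Z Z' ⟨Ψ⟩ =>
    ⟨((isTensorProduct_tensor X Z).exists_iso_of_iso (isTensorProduct_tensor X' Z') Φ Ψ).choose⟩⟩
instance : One (PicardGroup A) := ⟨mk (self A)⟩
instance : Inv (PicardGroup A) :=
  ⟨Quotient.map dual fun _ _ ⟨Φ⟩ => ⟨(exists_dual_iso Φ).choose⟩⟩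

lemma mk_mul_mk (X Z : EquivalenceBimodule A A) : mk X * mk Z = mk (tensor X Z) := rfl

lemma mk_mul_mk_eq {X Z T : EquivalenceBimodule A A} {τ : X →ₗ[ℂ] Z →ₗ[ℂ] T}
    (h : IsTensorProduct X Z T τ) : mk X * mk Z = mk T :=
  mk_eq_mk.2 ⟨((isTensorProduct_tensor X Z).exists_iso_of_iso h (Iso.refl X) (Iso.refl Z)).choose⟩

/-- The group structure: `[X][Z] = [X ⊗_A Z]`, `1 = [A]` and `[X]⁻¹ = [X̃]`. -/
instance : Group (PicardGroup A) :=
  Group.ofLeftAxioms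
    (by
      rintro ⟨X⟩ ⟨Z⟩ ⟨W⟩
      exact mk_eq_mk.2 ⟨((isTensorProduct_tensor X Z).exists_assoc (isTensorProduct_tensor Z W)
        (isTensorProduct_tensor _ W) (isTensorProduct_tensor X _)).choose⟩)
    (by
      rintro ⟨X⟩
      exact mk_mul_mk_eq (isTensorProduct_self X))
    (by
      rintro ⟨X⟩
      exact mk_mul_mk_eq (isTensorProduct_dual X))

end PicardGroup

/-- An inclusion of C*-algebras `A ⊂ C` with `AC` spanning a dense subspace of `C`. -/
structure CStarInclusion (C : Type u) [NonUnitalCStarAlgebra C] where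
  /-- the C*-subalgebra `A` of `C` -/
  sub : NonUnitalStarSubalgebra ℂ C
  isClosed : IsClosed (sub : Set C)
  nondegenerate : cspan {c | ∃ a ∈ sub, ∃ c', a * c' = c} = ⊤

/-- The trivial inclusion `A ⊂ A`. -/
def CStarInclusion.refl (A : Type u) [NonUnitalCStarAlgebra A] : CStarInclusion A where
  sub := ⊤
  isClosed := isClosed_univ
  nondegenerate := eq_top_iff.2 fun a _ => EquivalenceBimodule.mem_of_mul_mem ⊤ isClosed_univ
    (a := a) trivial (isClosed_cspan _) fun e _ => subset_cspan ⟨a, trivial, e, rfl⟩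

/-- An element `(X, Y)` of `Equi(A, C)`: a `C`-`C`-equivalence bimodule `Y` and a closed subspace
`X` of `Y` such that `A · X ⊆ X` and `X · A ⊆ X`, the two inner products of elements of `X` lie in
`A` and span dense subspaces of `A`, and the inner products `⟨y, x⟩` with `y ∈ Y` and `x ∈ X`
span dense subspaces of `C`. -/
structure EquiPair {C : Type u} [NonUnitalCStarAlgebra C] (I : CStarInclusion C) where
  /-- the `C`-`C`-equivalence bimodule `Y` -/
  Y : EquivalenceBimodule C C
  /-- the subspace `X` of `Y` -/
  X : Submodule ℂ Y
  isClosed : IsClosed (X : Set Y)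
  lact_mem : ∀ a ∈ I.sub, ∀ x ∈ X, Y.lact a x ∈ X
  linner_mem : ∀ x ∈ X, ∀ y ∈ X, Y.linner x y ∈ I.sub
  linner_full : (cspan {a | ∃ x ∈ X, ∃ y ∈ X, Y.linner x y = a} : Set C) = I.sub
  linner_full_right : cspan {c | ∃ y, ∃ x ∈ X, Y.linner y x = c} = ⊤
  ract_mem : ∀ a ∈ I.sub, ∀ x ∈ X, Y.ract a x ∈ X
  rinner_mem : ∀ x ∈ X, ∀ y ∈ X, Y.rinner x y ∈ I.sub
  rinner_full : (cspan {a | ∃ x ∈ X, ∃ y ∈ X, Y.rinner x y = a} : Set C) = I.sub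
  rinner_full_right : cspan {c | ∃ y, ∃ x ∈ X, Y.rinner y x = c} = ⊤

namespace EquiPair

open EquivalenceBimodule

variable {C : Type u} [NonUnitalCStarAlgebra C] {I : CStarInclusion C}

/-- `(X, Y) ∼ (Z, W)`: there is an isomorphism of `Y` onto `W` which maps `X` onto `Z`. (It then
restricts to an isomorphism of `X` onto `Z`, whose actions and inner products are those of `Y` and
`W`.) -/
instance setoid (I : CStarInclusion C) : Setoid (EquiPair I) where
  r P Q := ∃ Φ : Iso P.Y Q.Y, Φ '' P.X = Q.X
  iseqv := by
    refine ⟨fun P => ⟨Iso.refl _, ?_⟩, ?_, ?_⟩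
    · exact Set.image_id _
    · rintro P Q ⟨Φ, h⟩
      refine ⟨Φ.symm, ?_⟩
      rw [← h, ← Set.image_comp]
      convert Set.image_id _
      ext x
      simp
    · rintro P Q R ⟨Φ, h⟩ ⟨Ψ, h'⟩
      refine ⟨Φ.trans Ψ, ?_⟩
      rw [← h', ← h, ← Set.image_comp]
      rfl

lemma image_cspan {A B : Type u} [NonUnitalCStarAlgebra A] [NonUnitalCStarAlgebra B]
    {X Y : EquivalenceBimodule A B} (Φ : Iso X Y) {s : Set X} {t : Set Y}
    (h : ∀ x ∈ s, Φ x ∈ cspan t) (h' : ∀ y ∈ t, Φ.symm y ∈ cspan s) :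
    Φ '' (cspan s) = (cspan t : Set Y) := by
  ext y
  constructor
  · rintro ⟨x, hx, rfl⟩
    exact cspan_map Φ.toLinearEquiv.toLinearMap Φ.continuous (isClosed_cspan _) h hx
  · intro hy
    exact ⟨Φ.symm y, cspan_map Φ.symm.toLinearEquiv.toLinearMap Φ.symm.continuous
      (isClosed_cspan _) h' hy, by simp⟩

/-- `A` as a closed linear subspace of `C`. -/
def subL (I : CStarInclusion C) : Submodule ℂ C := I.sub.toSubmodule

lemma mem_subL {c : C} : c ∈ subL I ↔ c ∈ I.sub := Iff.rfl
lemma isClosed_subL : IsClosed (subL I : Set C) := I.isClosed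

lemma linner_full_iff (P : EquiPair I) {c : C} :
    c ∈ I.sub ↔ c ∈ cspan {a | ∃ x ∈ P.X, ∃ y ∈ P.X, P.Y.linner x y = a} := by
  rw [← SetLike.mem_coe, ← P.linner_full, SetLike.mem_coe]
lemma rinner_full_iff (P : EquiPair I) {c : C} :
    c ∈ I.sub ↔ c ∈ cspan {a | ∃ x ∈ P.X, ∃ y ∈ P.X, P.Y.rinner x y = a} := by
  rw [← SetLike.mem_coe, ← P.rinner_full, SetLike.mem_coe]

lemma tensorOf_linner_mem {P Q : EquiPair I} {T : EquivalenceBimodule C C}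
    {τ : P.Y →ₗ[ℂ] Q.Y →ₗ[ℂ] T} (h : IsTensorProduct P.Y Q.Y T τ) {s t : T}
    (hs : s ∈ cspan {t | ∃ x ∈ P.X, ∃ z ∈ Q.X, τ x z = t})
    (ht : t ∈ cspan {t | ∃ x ∈ P.X, ∃ z ∈ Q.X, τ x z = t}) : T.linner s t ∈ I.sub := by
  refine cspan_map (K := subL I) (T.linner.flip t)
    (show Continuous fun s => T.linner s t by fun_prop) isClosed_subL ?_ hs
  rintro _ ⟨x, hx, z, hz, rfl⟩
  refine cspan_map (K := subL I) (T.linner (τ x z)) (by fun_prop) isClosed_subL ?_ ht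
  rintro _ ⟨x', hx', z', hz', rfl⟩
  rw [h.linner]
  exact P.linner_mem _ (P.ract_mem _ (Q.linner_mem z hz z' hz') x hx) x' hx'

lemma tensorOf_rinner_mem {P Q : EquiPair I} {T : EquivalenceBimodule C C}
    {τ : P.Y →ₗ[ℂ] Q.Y →ₗ[ℂ] T} (h : IsTensorProduct P.Y Q.Y T τ) {s t : T}
    (hs : s ∈ cspan {t | ∃ x ∈ P.X, ∃ z ∈ Q.X, τ x z = t})
    (ht : t ∈ cspan {t | ∃ x ∈ P.X, ∃ z ∈ Q.X, τ x z = t}) : T.rinner s t ∈ I.sub := by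
  refine cspan_map (K := subL I) (T.rinner.flip t)
    (show Continuous fun s => T.rinner s t by fun_prop) isClosed_subL ?_ hs
  rintro _ ⟨x, hx, z, hz, rfl⟩
  refine cspan_map (K := subL I) (T.rinner (τ x z)) (by fun_prop) isClosed_subL ?_ ht
  rintro _ ⟨x', hx', z', hz', rfl⟩
  rw [h.rinner]
  exact Q.rinner_mem z hz _ (Q.lact_mem _ (P.rinner_mem x hx x' hx') z' hz')

/-- The pair `(X ⊗ Z, Y ⊗ W)`, where `X ⊗ Z` is the closed linear span in `Y ⊗ W` of the `x ⊗ z`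
with `x ∈ X` and `z ∈ Z`. -/
def tensorOf (P Q : EquiPair I) {T : EquivalenceBimodule C C} {τ : P.Y →ₗ[ℂ] Q.Y →ₗ[ℂ] T}
    (h : IsTensorProduct P.Y Q.Y T τ) : EquiPair I where
  Y := T
  X := cspan {t | ∃ x ∈ P.X, ∃ z ∈ Q.X, τ x z = t}
  isClosed := isClosed_cspan _
  lact_mem a ha t ht := by
    refine cspan_map (T.lact a) (by fun_prop) (isClosed_cspan _) ?_ ht
    rintro _ ⟨x, hx, z, hz, rfl⟩
    exact subset_cspan ⟨_, P.lact_mem a ha x hx, z, hz, (h.lact _ _ _).symm⟩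
  ract_mem a ha t ht := by
    refine cspan_map (T.ract a) (by fun_prop) (isClosed_cspan _) ?_ ht
    rintro _ ⟨x, hx, z, hz, rfl⟩
    exact subset_cspan ⟨x, hx, _, Q.ract_mem a ha z hz, (h.ract _ _ _).symm⟩
  linner_mem s hs t ht := tensorOf_linner_mem h hs ht
  rinner_mem s hs t ht := tensorOf_rinner_mem h hs ht
  linner_full := by
    ext c
    rw [SetLike.mem_coe, SetLike.mem_coe]
    set S := cspan {t | ∃ x ∈ P.X, ∃ z ∈ Q.X, τ x z = t}
    set K := cspan {c | ∃ s ∈ S, ∃ t ∈ S, T.linner s t = c}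
    have hK : IsClosed (K : Set C) := isClosed_cspan _
    constructor
    · refine cspan_le (K := subL I) isClosed_subL ?_
      rintro _ ⟨s, hs, t, ht, rfl⟩
      exact tensorOf_linner_mem h hs ht
    rw [P.linner_full_iff]
    refine cspan_le hK ?_
    rintro _ ⟨x, hx, x', hx', rfl⟩
    refine P.Y.mem_of_ract_mem I.sub I.isClosed x (P.rinner_mem x hx x hx)
      {y | P.Y.linner y x' ∈ K} (hK.preimage (by fun_prop)) fun b hb => ?_
    rw [Q.linner_full_iff] at hb
    refine cspan_map ((P.Y.linner.flip x').comp (P.Y.ract.flip x))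
      (show Continuous fun b => P.Y.linner (P.Y.ract b x) x' by fun_prop) hK ?_ hb
    rintro _ ⟨z, hz, z', hz', rfl⟩
    exact subset_cspan ⟨τ x z, subset_cspan ⟨x, hx, z, hz, rfl⟩, τ x' z',
      subset_cspan ⟨x', hx', z', hz', rfl⟩, h.linner _ _ _ _⟩
  rinner_full := by
    ext c
    rw [SetLike.mem_coe, SetLike.mem_coe]
    set S := cspan {t | ∃ x ∈ P.X, ∃ z ∈ Q.X, τ x z = t}
    set K := cspan {c | ∃ s ∈ S, ∃ t ∈ S, T.rinner s t = c}
    have hK : IsClosed (K : Set C) := isClosed_cspan _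
    constructor
    · refine cspan_le (K := subL I) isClosed_subL ?_
      rintro _ ⟨s, hs, t, ht, rfl⟩
      exact tensorOf_rinner_mem h hs ht
    rw [Q.rinner_full_iff]
    refine cspan_le hK ?_
    rintro _ ⟨z, hz, z', hz', rfl⟩
    refine Q.Y.mem_of_lact_mem I.sub I.isClosed z' (Q.linner_mem z' hz' z' hz')
      {y | Q.Y.rinner z y ∈ K} (hK.preimage (by fun_prop)) fun b hb => ?_
    rw [P.rinner_full_iff] at hb
    refine cspan_map ((Q.Y.rinner z).comp (Q.Y.lact.flip z'))
      (show Continuous fun b => Q.Y.rinner z (Q.Y.lact b z') by fun_prop) hK ?_ hb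
    rintro _ ⟨x, hx, x', hx', rfl⟩
    exact subset_cspan ⟨τ x z, subset_cspan ⟨x, hx, z, hz, rfl⟩, τ x' z',
      subset_cspan ⟨x', hx', z', hz', rfl⟩, h.rinner _ _ _ _⟩
  linner_full_right := by
    set K := cspan {c | ∃ s, ∃ t ∈ cspan {t | ∃ x ∈ P.X, ∃ z ∈ Q.X, τ x z = t}, T.linner s t = c}
    have hK : IsClosed (K : Set C) := isClosed_cspan _
    refine eq_top_iff.2 fun c _ => cspan_eq_top_of P.linner_full_right hK ?_ c
    rintro _ ⟨y, x, hx, rfl⟩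
    refine P.Y.mem_of_ract_mem ⊤ isClosed_univ y trivial {y | P.Y.linner y x ∈ K}
      (hK.preimage (by fun_prop)) fun b _ => ?_
    refine cspan_map_top Q.linner_full_right ((P.Y.linner.flip x).comp (P.Y.ract.flip y))
      (show Continuous fun b => P.Y.linner (P.Y.ract b y) x by fun_prop) hK ?_ b
    rintro _ ⟨w, z, hz, rfl⟩
    exact subset_cspan ⟨τ y w, τ x z, subset_cspan ⟨x, hx, z, hz, rfl⟩, h.linner _ _ _ _⟩
  rinner_full_right := by
    set K := cspan {c | ∃ s, ∃ t ∈ cspan {t | ∃ x ∈ P.X, ∃ z ∈ Q.X, τ x z = t}, T.rinner s t = c}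
    have hK : IsClosed (K : Set C) := isClosed_cspan _
    refine eq_top_iff.2 fun c _ => cspan_eq_top_of Q.rinner_full_right hK ?_ c
    rintro _ ⟨w, z, hz, rfl⟩
    refine Q.Y.mem_of_lact_mem ⊤ isClosed_univ z trivial {z | Q.Y.rinner w z ∈ K}
      (hK.preimage (by fun_prop)) fun b _ => ?_
    refine cspan_map_top P.rinner_full_right ((Q.Y.rinner w).comp (Q.Y.lact.flip z))
      (show Continuous fun b => Q.Y.rinner w (Q.Y.lact b z) by fun_prop) hK ?_ b
    rintro _ ⟨y, x, hx, rfl⟩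
    exact subset_cspan ⟨τ y w, τ x z, subset_cspan ⟨x, hx, z, hz, rfl⟩, h.rinner _ _ _ _⟩

/-- The product `(X ⊗_A Z, Y ⊗_C W)`. -/
def tensor (P Q : EquiPair I) : EquiPair I := P.tensorOf Q (isTensorProduct_tensor P.Y Q.Y)

/-- The pair `(A, C)`. -/
def self (I : CStarInclusion C) : EquiPair I where
  Y := EquivalenceBimodule.self C
  X := (subL I).map (toSelf C).toLinearMap
  isClosed := by
    have h : (((subL I).map (toSelf C).toLinearMap : Submodule ℂ (EquivalenceBimodule.self C)) :
        Set (EquivalenceBimodule.self C)) = (I.sub : Set C) := Set.image_id (I.sub : Set C)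
    rw [h]
    exact I.isClosed
  lact_mem := by
    rintro a ha _ ⟨x, hx, rfl⟩
    exact ⟨a * x, I.sub.mul_mem ha hx, rfl⟩
  ract_mem := by
    rintro a ha _ ⟨x, hx, rfl⟩
    exact ⟨x * a, I.sub.mul_mem hx ha, rfl⟩
  linner_mem := by
    rintro _ ⟨x, hx, rfl⟩ _ ⟨y, hy, rfl⟩
    exact I.sub.mul_mem hx (I.sub.star_mem' hy)
  rinner_mem := by
    rintro _ ⟨x, hx, rfl⟩ _ ⟨y, hy, rfl⟩
    exact I.sub.mul_mem (I.sub.star_mem' hx) hy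
  linner_full := by
    apply Set.Subset.antisymm
    · refine fun c hc => cspan_le (K := subL I) isClosed_subL ?_ hc
      rintro _ ⟨_, ⟨x, hx, rfl⟩, _, ⟨y, hy, rfl⟩, rfl⟩
      exact I.sub.mul_mem hx (I.sub.star_mem' hy)
    · refine fun c hc => mem_of_mul_mem I.sub I.isClosed hc (isClosed_cspan _) fun e he =>
        subset_cspan ⟨toSelf C c, ⟨c, hc, rfl⟩, toSelf C (star e), ⟨_, I.sub.star_mem' he, rfl⟩, ?_⟩
      rw [self_linner, star_star]
  rinner_full := by
    apply Set.Subset.antisymm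
    · refine fun c hc => cspan_le (K := subL I) isClosed_subL ?_ hc
      rintro _ ⟨_, ⟨x, hx, rfl⟩, _, ⟨y, hy, rfl⟩, rfl⟩
      exact I.sub.mul_mem (I.sub.star_mem' hx) hy
    · refine fun c hc => mem_of_mul_mem I.sub I.isClosed hc (isClosed_cspan _) fun e he =>
        subset_cspan ⟨toSelf C (star c), ⟨_, I.sub.star_mem' hc, rfl⟩, toSelf C e, ⟨_, he, rfl⟩, ?_⟩
      rw [self_rinner, star_star]
  linner_full_right := by
    refine eq_top_iff.2 fun c _ => ?_
    rw [← star_star c]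
    refine cspan_map_top I.nondegenerate (starLinearEquiv ℂ (A := C)).toLinearMap
      continuous_star (isClosed_cspan _) ?_ (star c)
    rintro _ ⟨a, ha, c', rfl⟩
    refine subset_cspan ⟨toSelf C (star c'), toSelf C a, ⟨a, ha, rfl⟩, ?_⟩
    rw [self_linner, ← star_mul]; rfl
  rinner_full_right := by
    refine eq_top_iff.2 fun c _ => ?_
    rw [← star_star c]
    refine cspan_map_top I.nondegenerate (starLinearEquiv ℂ (A := C)).toLinearMap
      continuous_star (isClosed_cspan _) ?_ (star c)
    rintro _ ⟨a, ha, c', rfl⟩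
    refine subset_cspan ⟨toSelf C c', toSelf C (star a), ⟨_, I.sub.star_mem' ha, rfl⟩, ?_⟩
    rw [self_rinner, ← star_mul]; rfl

/-- The dual pair `(X̃, Ỹ)`. -/
def dual (P : EquiPair I) : EquiPair I where
  Y := P.Y.dual
  X := P.X.map P.Y.toDual.toLinearMap
  isClosed := by
    have h : ((P.X.map P.Y.toDual.toLinearMap : Submodule ℂ P.Y.dual) : Set P.Y.dual) =
        (P.X : Set P.Y) := Set.image_id (P.X : Set P.Y)
    rw [h]
    exact P.isClosed
  lact_mem := by
    rintro a ha _ ⟨x, hx, rfl⟩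
    exact ⟨_, P.ract_mem _ (star_mem ha) x hx, rfl⟩
  ract_mem := by
    rintro a ha _ ⟨x, hx, rfl⟩
    exact ⟨_, P.lact_mem _ (star_mem ha) x hx, rfl⟩
  linner_mem := by
    rintro _ ⟨x, hx, rfl⟩ _ ⟨y, hy, rfl⟩
    exact P.rinner_mem x hx y hy
  rinner_mem := by
    rintro _ ⟨x, hx, rfl⟩ _ ⟨y, hy, rfl⟩
    exact P.linner_mem x hx y hy
  linner_full := by
    rw [← P.rinner_full]
    congr 2
    ext c
    constructor
    · rintro ⟨_, ⟨x, hx, rfl⟩, _, ⟨y, hy, rfl⟩, rfl⟩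
      exact ⟨x, hx, y, hy, rfl⟩
    · rintro ⟨x, hx, y, hy, rfl⟩
      exact ⟨_, ⟨x, hx, rfl⟩, _, ⟨y, hy, rfl⟩, rfl⟩
  rinner_full := by
    rw [← P.linner_full]
    congr 2
    ext c
    constructor
    · rintro ⟨_, ⟨x, hx, rfl⟩, _, ⟨y, hy, rfl⟩, rfl⟩
      exact ⟨x, hx, y, hy, rfl⟩
    · rintro ⟨x, hx, y, hy, rfl⟩
      exact ⟨_, ⟨x, hx, rfl⟩, _, ⟨y, hy, rfl⟩, rfl⟩
  linner_full_right := by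
    rw [← P.rinner_full_right]
    congr 1
    ext c
    constructor
    · rintro ⟨y, _, ⟨x, hx, rfl⟩, rfl⟩
      exact ⟨P.Y.toDual.symm y, x, hx, rfl⟩
    · rintro ⟨y, x, hx, rfl⟩
      exact ⟨P.Y.toDual y, _, ⟨x, hx, rfl⟩, rfl⟩
  rinner_full_right := by
    rw [← P.linner_full_right]
    congr 1
    ext c
    constructor
    · rintro ⟨y, _, ⟨x, hx, rfl⟩, rfl⟩
      exact ⟨P.Y.toDual.symm y, x, hx, rfl⟩
    · rintro ⟨y, x, hx, rfl⟩
      exact ⟨P.Y.toDual y, _, ⟨x, hx, rfl⟩, rfl⟩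

/-- The pair `(X, X)` over the trivial inclusion `A ⊂ A`. -/
def diag (X : EquivalenceBimodule C C) : EquiPair (CStarInclusion.refl C) where
  Y := X
  X := ⊤
  isClosed := isClosed_univ
  lact_mem _ _ _ _ := trivial
  ract_mem _ _ _ _ := trivial
  linner_mem _ _ _ _ := trivial
  rinner_mem _ _ _ _ := trivial
  linner_full := by
    have h := X.linner_full
    simp only [Submodule.mem_top, true_and]
    rw [h]; rfl
  rinner_full := by
    have h := X.rinner_full
    simp only [Submodule.mem_top, true_and]
    rw [h]; rfl
  linner_full_right := by
    have h := X.linner_full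
    simp only [Submodule.mem_top, true_and]
    rw [h]
  rinner_full_right := by
    have h := X.rinner_full
    simp only [Submodule.mem_top, true_and]
    rw [h]

lemma tensorOf_equiv {P P' Q Q' : EquiPair I} {T T' : EquivalenceBimodule C C}
    {τ : P.Y →ₗ[ℂ] Q.Y →ₗ[ℂ] T} {τ' : P'.Y →ₗ[ℂ] Q'.Y →ₗ[ℂ] T'}
    (h : IsTensorProduct P.Y Q.Y T τ) (h' : IsTensorProduct P'.Y Q'.Y T' τ')
    (hP : P ≈ P') (hQ : Q ≈ Q') : P.tensorOf Q h ≈ P'.tensorOf Q' h' := by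
  obtain ⟨Φ, hΦ⟩ := hP
  obtain ⟨Ψ, hΨ⟩ := hQ
  obtain ⟨Θ, hΘ⟩ := h.exists_iso_of_iso h' Φ Ψ
  refine ⟨Θ, image_cspan Θ ?_ ?_⟩
  · rintro _ ⟨x, hx, z, hz, rfl⟩
    refine subset_cspan ⟨Φ x, ?_, Ψ z, ?_, (hΘ x z).symm⟩
    · exact hΦ.subset ⟨x, hx, rfl⟩
    · exact hΨ.subset ⟨z, hz, rfl⟩
  · rintro _ ⟨x, hx, z, hz, rfl⟩
    obtain ⟨x, hx, rfl⟩ := hΦ.superset hx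
    obtain ⟨z, hz, rfl⟩ := hΨ.superset hz
    rw [← hΘ, Iso.symm_apply_apply]
    exact subset_cspan ⟨x, by assumption, z, by assumption, rfl⟩

lemma tensorOf_assoc (P Q R : EquiPair I) : (P.tensor Q).tensor R ≈ P.tensor (Q.tensor R) := by
  obtain ⟨Θ, hΘ⟩ := (isTensorProduct_tensor P.Y Q.Y).exists_assoc (isTensorProduct_tensor Q.Y R.Y)
    (isTensorProduct_tensor _ R.Y) (isTensorProduct_tensor P.Y _)
  refine ⟨Θ, image_cspan Θ ?_ ?_⟩
  · rintro _ ⟨t, ht, w, hw, rfl⟩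
    refine cspan_map (Θ.toLinearEquiv.toLinearMap.comp ((tmul _ _).flip w))
      (Θ.continuous.comp ((isTensorProduct_tensor _ _).continuous continuous_id continuous_const))
      (isClosed_cspan _) ?_ ht
    rintro _ ⟨x, hx, z, hz, rfl⟩
    exact subset_cspan ⟨x, hx, _, subset_cspan ⟨z, hz, w, hw, rfl⟩, (hΘ x z w).symm⟩
  · rintro _ ⟨x, hx, t, ht, rfl⟩
    refine cspan_map (Θ.symm.toLinearEquiv.toLinearMap.comp (tmul _ _ x))
      (Θ.symm.continuous.comp
        ((isTensorProduct_tensor _ _).continuous continuous_const continuous_id))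
      (isClosed_cspan _) ?_ ht
    rintro _ ⟨z, hz, w, hw, rfl⟩
    refine subset_cspan ⟨_, subset_cspan ⟨x, hx, z, hz, rfl⟩, w, hw, ?_⟩
    change _ = Θ.symm _
    rw [← hΘ, Iso.symm_apply_apply]
    rfl

lemma dual_equiv {P Q : EquiPair I} (h : P ≈ Q) : P.dual ≈ Q.dual := by
  obtain ⟨Φ, hΦ⟩ := h
  obtain ⟨Ψ, hΨ⟩ := exists_dual_iso Φ
  refine ⟨Ψ, ?_⟩
  ext y
  constructor
  · rintro ⟨_, ⟨x, hx, rfl⟩, rfl⟩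
    exact ⟨Φ x, hΦ.subset ⟨x, hx, rfl⟩, (hΨ x).symm⟩
  · rintro ⟨z, hz, rfl⟩
    obtain ⟨x, hx, rfl⟩ := hΦ.superset hz
    exact ⟨_, ⟨x, hx, rfl⟩, hΨ x⟩

end EquiPair

/-- The Picard group of an inclusion `A ⊂ C` of C*-algebras: equivalence classes of pairs
`(X, Y)` in `Equi(A, C)`. -/
def InclusionPicardGroup {C : Type u} [NonUnitalCStarAlgebra C] (I : CStarInclusion C) :
    Type (u + 1) :=
  Quotient (EquiPair.setoid I)

namespace InclusionPicardGroup

open EquivalenceBimodule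

variable {C : Type u} [NonUnitalCStarAlgebra C] {I : CStarInclusion C}

/-- The class `[X, Y]`. -/
def mk (P : EquiPair I) : InclusionPicardGroup I := Quotient.mk _ P

lemma mk_eq_mk {P Q : EquiPair I} : mk P = mk Q ↔ P ≈ Q := Quotient.eq

instance : Mul (InclusionPicardGroup I) :=
  ⟨Quotient.map₂ EquiPair.tensor fun _ _ h _ _ h' => EquiPair.tensorOf_equiv _ _ h h'⟩
instance : One (InclusionPicardGroup I) := ⟨mk (EquiPair.self I)⟩
instance : Inv (InclusionPicardGroup I) :=
  ⟨Quotient.map EquiPair.dual fun _ _ h => EquiPair.dual_equiv h⟩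

lemma mk_mul_mk_eq {P Q R : EquiPair I} {τ : P.Y →ₗ[ℂ] Q.Y →ₗ[ℂ] R.Y}
    (h : IsTensorProduct P.Y Q.Y R.Y τ)
    (hX : R.X = cspan {t | ∃ x ∈ P.X, ∃ z ∈ Q.X, τ x z = t}) : mk P * mk Q = mk R := by
  have h1 : P.tensorOf Q h ≈ R :=
    ⟨Iso.refl R.Y, (Set.image_id _).trans (congrArg SetLike.coe hX.symm)⟩
  exact mk_eq_mk.2 (Setoid.trans
    (EquiPair.tensorOf_equiv _ _ (Setoid.refl P) (Setoid.refl Q)) h1)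

/-- The group structure: `[X, Y][Z, W] = [X ⊗_A Z, Y ⊗_C W]`, `1 = [A, C]` and
`[X, Y]⁻¹ = [X̃, Ỹ]`. -/
instance : Group (InclusionPicardGroup I) :=
  Group.ofLeftAxioms
    (by
      rintro ⟨P⟩ ⟨Q⟩ ⟨R⟩
      exact mk_eq_mk.2 (EquiPair.tensorOf_assoc P Q R))
    (by
      rintro ⟨P⟩
      refine mk_mul_mk_eq (isTensorProduct_self P.Y) (le_antisymm (fun x hx => ?_) fun x hx => ?_)
      · exact P.Y.mem_of_lact_mem I.sub I.isClosed x (P.linner_mem x hx x hx) _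
          (isClosed_cspan _) fun e he => subset_cspan ⟨toSelf C e, ⟨e, he, rfl⟩, x, hx, rfl⟩
      · refine cspan_le P.isClosed ?_ hx
        rintro _ ⟨_, ⟨a, ha, rfl⟩, x, hx, rfl⟩
        exact P.lact_mem a ha x hx)
    (by
      rintro ⟨P⟩
      refine mk_mul_mk_eq (isTensorProduct_dual P.Y) (le_antisymm ?_ ?_)
      · rintro _ ⟨c, hc, rfl⟩
        have hc := P.rinner_full_iff.1 hc
        refine cspan_map (toSelf C).toLinearMap continuous_id (isClosed_cspan _) ?_ hc
        rintro _ ⟨x, hx, y, hy, rfl⟩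
        exact subset_cspan ⟨P.Y.toDual x, ⟨x, hx, rfl⟩, y, hy, rfl⟩
      · intro c hc
        refine cspan_le (EquiPair.self I).isClosed ?_ hc
        rintro _ ⟨_, ⟨x, hx, rfl⟩, y, hy, rfl⟩
        exact ⟨_, P.rinner_mem x hx y hy, rfl⟩)

end InclusionPicardGroup

end

/-! ### Rigidity of pairs over the identity inclusion -/

namespace EquiPair

open EquivalenceBimodule

variable {A : Type u} [NonUnitalCStarAlgebra A]

/-! A pair in Equi(A, A) carries no more information than its ambient bimodule: if X sits in Y as in
the definition, then X = Y. The reason is the identity y · ⟨z, x⟩ = ⟨y, z⟩ · x. For a general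
inclusion A ⊂ C the coefficient ⟨y, z⟩ lies in C only, and X is stable only under A. When C = A, the
right-hand side lies in X for all y, z in Y and x in X. Since the elements ⟨z, x⟩ span a dense
subspace of A and X is closed, y · b lies in X for every b in A. An approximate unit then gives y in
X; this replaces the choice b = 1, which is available only when A is unital. This is
`subspace_eq_top`, the one step of the proof that uses the structure of Hilbert modules.

Conversely, `EquiPair.diag` makes a pair (X, X) out of every A-A-equivalence bimodule X, the density
conditions being the fullness of X. So the objects on the two sides correspond. The equivalence
relations correspond as well, because an isomorphism Φ of the ambient bimodules is onto and
therefore maps the whole of the first onto the whole of the second; the condition on subspaces in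
the definition of ∼ is automatic (`diag_equiv_diag_iff`). Hence the map on classes is well defined
and injective, and rigidity makes it surjective (`diag_equiv`).

The products agree too. The product of (X, X) and (Z, Z) has as its subspace the closed span of all
x ⊗ z in X ⊗ Z, and this is everything because the elementary tensors span a dense subspace
(`mk_diag_mul_mk_diag`). Both sides are already known to be groups, so a multiplicative bijection
respects the unit and the inverses without further work. -/

/-- Over the trivial inclusion `A ⊂ A`, the subspace `X` of a pair `(X, Y)` is all of `Y`, since
`y · ⟨z, x⟩ = ⟨y, z⟩ · x` lies in `X` for `x ∈ X`. -/
lemma subspace_eq_top (P : EquiPair (CStarInclusion.refl A)) : P.X = ⊤ := by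
  -- It suffices to show y · b ∈ X for all b in A. With q = ⟨y, y⟩ and ‖e‖ ≤ 1 one has ‖y - y · e‖²
  -- ≤ 2 ‖q - q e‖, and an approximate unit makes the right-hand side small, so y is a limit of
  -- elements y · e and the closed set X contains it.
  refine eq_top_iff.2 fun y _ => P.Y.mem_of_ract_mem ⊤ isClosed_univ y trivial P.X P.isClosed
    fun b _ => ?_
  -- For fixed y the map b ↦ y · b is linear and continuous and X is a closed subspace, so it is
  -- enough to take b = ⟨z, x⟩ with z ∈ Y and x ∈ X: these span a dense subspace of A. It matters
  -- that z ranges over all of Y while the second entry x is in X, since x is the vector that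
  -- survives when the inner product is moved to the left.
  refine cspan_map_top P.rinner_full_right (P.Y.ract.flip y)
    (show Continuous fun b => P.Y.ract b y by fun_prop) P.isClosed ?_ b
  rintro _ ⟨z, x, hx, rfl⟩
  rw [LinearMap.flip_apply, ← P.Y.lact_linner]
  -- Here the two algebras must coincide: `trivial` says that the coefficient ⟨y, z⟩, a priori an
  -- arbitrary element of the large algebra, belongs to the subalgebra under which X is stable.
  exact P.lact_mem _ trivial x hx

/-- This is what surjectivity of [X] ↦ [X, X] needs. The two pairs have the same ambient bimodule
and, by `subspace_eq_top`, the same subspace, so the identity map is an equivalence between them. -/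
lemma diag_equiv (P : EquiPair (CStarInclusion.refl A)) : diag P.Y ≈ P :=
  ⟨Iso.refl P.Y, (Set.image_id _).trans (congrArg SetLike.coe P.subspace_eq_top.symm)⟩

/-- Both subspaces are the whole bimodule, and an isomorphism, being onto, carries one to the other.
The backward implication makes [X] ↦ [X, X] well defined; the forward one makes it injective. -/
lemma diag_equiv_diag_iff {X Y : EquivalenceBimodule A A} :
    diag X ≈ diag Y ↔ Nonempty (Iso X Y) :=
  ⟨fun ⟨Φ, _⟩ => ⟨Φ⟩, fun ⟨Φ⟩ => ⟨Φ, Set.image_univ_of_surjective Φ.surjective⟩⟩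

end EquiPair

/-! ### The homomorphism from the Picard group of the algebra to that of the identity inclusion -/

namespace InclusionPicardGroup

open EquivalenceBimodule

variable {A : Type u} [NonUnitalCStarAlgebra A]

/-- Multiplicativity on representatives. The ambient bimodule of the product is X ⊗ Z by definition;
what has to be seen is that its distinguished subspace, the closed span of the elementary tensors,
is all of X ⊗ Z, which is the density built into the tensor product. -/
lemma mk_diag_mul_mk_diag (X Z : EquivalenceBimodule A A) :
    mk (EquiPair.diag X) * mk (EquiPair.diag Z) = mk (EquiPair.diag (tensor X Z)) := by
  refine mk_mul_mk_eq (R := EquiPair.diag (tensor X Z)) (isTensorProduct_tensor X Z)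
    (Eq.symm (eq_top_iff.2 ?_))
  -- The density statement ranges over all x and z, while the subspace of the product is spanned by
  -- x ⊗ z with the added conditions x ∈ ⊤ and z ∈ ⊤. The two closed spans are therefore compared on
  -- generators, where these conditions hold trivially.
  refine fun t _ => cspan_eq_top_of (isTensorProduct_tensor X Z).dense (isClosed_cspan _) ?_ t
  rintro _ ⟨x, z, rfl⟩
  exact subset_cspan ⟨x, trivial, z, trivial, rfl⟩

/-- The homomorphism `[X] ↦ [X, X]`. -/
noncomputable def diagHom (A : Type u) [NonUnitalCStarAlgebra A] :
    PicardGroup A →* InclusionPicardGroup (CStarInclusion.refl A) :=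
  -- Source and target are groups, so multiplicativity alone is enough: that [A] goes to the unit
  -- [A, A] follows by cancellation.
  MonoidHom.mk' (Quotient.map EquiPair.diag fun _ _ h => EquiPair.diag_equiv_diag_iff.2 h) (by
    rintro ⟨X⟩ ⟨Z⟩
    -- The product of the classes of X and Z in the source is by definition the class of `tensor X
    -- Z`, so the goal unfolds to the lemma read from right to left.
    exact (mk_diag_mul_mk_diag X Z).symm)

lemma diagHom_mk (X : EquivalenceBimodule A A) :
    diagHom A (PicardGroup.mk X) = mk (EquiPair.diag X) := rfl

/-- Injectivity only forgets the condition on subspaces: an equivalence of (X, X) with (Y, Y) is in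
particular an isomorphism of X onto Y. Surjectivity is where rigidity enters. -/
lemma diagHom_bijective : Function.Bijective (diagHom A) := by
  constructor
  · rintro ⟨X⟩ ⟨Y⟩ h
    exact PicardGroup.mk_eq_mk.2 (EquiPair.diag_equiv_diag_iff.1 (mk_eq_mk.1 h))
  · rintro ⟨P⟩
    -- The preimage of [X, Y] is the class of the ambient bimodule Y, which is an A-A-equivalence
    -- bimodule because the large algebra is A itself.
    exact ⟨PicardGroup.mk P.Y, mk_eq_mk.2 P.diag_equiv⟩

end InclusionPicardGroup

/-- The prescribed values on representatives determine j, since every element of the Picard group of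
A is the class of some X. That such a j exists at all includes the claim that [X, X] depends only on
the class of X. -/
theorem mainTheorem9 (A : Type u) [NonUnitalCStarAlgebra A] :
    ∃ j : PicardGroup A ≃* InclusionPicardGroup (CStarInclusion.refl A),
      ∀ X : EquivalenceBimodule A A,
        j (PicardGroup.mk X) = InclusionPicardGroup.mk (EquiPair.diag X) :=
  ⟨MulEquiv.ofBijective (InclusionPicardGroup.diagHom A) InclusionPicardGroup.diagHom_bijective,
    InclusionPicardGroup.diagHom_mk⟩
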